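/- For $\nu,z\in\mathbb{C}$ let $I_\nu(z)=\sum_{k=0}^\infty \frac{(z/2)^{2k+\nu}}{k!\,\Gamma(k+\nu+1)}$ be the modified Bessel function of the first kind, let ${}_1F_1(a;b;z)=\sum_{n=0}^\infty \frac{(a)_n}{(b)_n}\frac{z^n}{n!}$ be the Kummer confluent hypergeometric function, and for $x>0$, $\tau\in\mathbb{R}$ let $$\Psi_\tau(x)=\frac{\sqrt{\pi}}{\cosh(\pi\tau)}\,e^{-x/2}\,\mathrm{Re}\left[I_{i\tau}\left(\frac{x}{2}\right)\right].$$ (i) For all $x,y>0$ the following integral converges absolutely and has the value $$\int_0^\infty \frac{\cos(\tau y)}{\cosh(\pi\tau)}\,\mathrm{Re}\left[I_{i\tau}\left(\frac{x}{2}\right)\right]d\tau=\sqrt{\frac{x}{\pi}}\;e^{x/2}\cosh\left(\frac{y}{2}\right)\,{}_1F_1\left(1;\frac32;-x\cosh^2\left(\frac{y}{2}\right)\right).$$ (ii) For all $x>0$ and $\tau\in\mathbb{R}$, $$\Psi_\tau(x)=\frac{2\sqrt{x}}{\pi}\int_0^\infty\cos(\tau y)\cosh\left(\frac{y}{2}\right)\,{}_1F_1\left(1;\frac32;-x\cosh^2\left(\frac{y}{2}\right)\right)dy,$$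 where the integral converges absolutely. -/

import Mathlib

/-- The modified Bessel function of the first kind of order `ν`, by its power series
`I_ν(z) = ∑ (z/2)^(2k+ν) / (k! Γ(k+ν+1))`, with the principal branch of the power.
Mathlib's `Complex.Gamma` takes the value `0` at its poles, and division by `0` gives `0`, so a term
whose Gamma factor has a pole is `0`, as it should be. -/
noncomputable def besselI (ν z : ℂ) : ℂ :=
  ∑' k : ℕ, (z / 2) ^ (2 * (k : ℂ) + ν) / ((k.factorial : ℂ) * Complex.Gamma ((k : ℂ) + ν + 1))

/-- The Kummer confluent hypergeometric function `₁F₁(a; b; z) = ∑ (a)_n / (b)_n * z^n / n!`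
(over `ℝ` or `ℂ`, for `b` not a nonpositive integer), `(a)_n` being the rising factorial. -/
noncomputable def kummerF {𝕜 : Type*} [RCLike 𝕜] (a b z : 𝕜) : 𝕜 :=
  ∑' n : ℕ, (ascPochhammer 𝕜 n).eval a / (ascPochhammer 𝕜 n).eval b * (z ^ n / (n.factorial : 𝕜))

/-- The kernel `Ψ_τ(x) = √π / cosh(πτ) * e^(-x/2) * Re I_{iτ}(x/2)` of the Lebedev–Skalskaya type
index transform. -/
noncomputable def lebedevSkalskayaKernel (τ x : ℝ) : ℝ :=
  √Real.pi / Real.cosh (Real.pi * τ) * Real.exp (-x / 2) *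
    (besselI (Complex.I * (τ : ℂ)) ((x / 2 : ℝ) : ℂ)).re

/-!
The identities are two halves of a Fourier cosine inversion, so everything rests on the second one,
`lebedevSkalskayaKernel_eq_integral`; it is proved by comparing Laplace transforms in `x`
(`cosineTransform_eq`).

On the hypergeometric side, Euler's integral `₁F₁(1; 3/2; -t) = ∫₀¹ exp (-t (1 - s²)) ds`
(`kummerF_eq_integral`) gives the bound `₁F₁(1; 3/2; -t) ≤ 1 / t`, which makes all integrals in `y`
converge absolutely, and the transform of `√x ₁F₁(1; 3/2; -a x)`, which is
`(√π / 2) / (√p (p + a))`. At `p = sinh² (u / 2)` and `a = cosh² (y / 2)` the remaining integral in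
`y` is that of `cos (τy)` against the sum of two translates of `1 / cosh (y / 2)`, and the Fourier
transform of `1 / cosh` is the Beta integral `B(1/2 + iτ, 1/2 - iτ)`
(`integrable_and_integral_exp_div_cosh`).

On the Bessel side, integrating `I_{iτ}` termwise and writing `1 / (2 cosh u) = exp (-u) / (1 + r)`
with `r = exp (-2u)`, one is left with the binomial sum `hasSum_ascPochhammer_mul_cpow`, whose
coefficients are `n`-th differences of a monic polynomial of degree `n`. The outcome is
`∫ exp (-z cosh u) I_{iτ}(z) dz = exp (-iτu) / sinh u` for `u ≥ 2` (`integral_exp_mul_besselI`).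
The two transforms agree on a half-line, and by Weierstrass approximation this determines a
continuous function on `(0, ∞)` (`eq_zero_of_laplace_eq_zero`).

For the first identity, `|I_{iτ}(z)| ≤ cosh z / |Γ(1 + iτ)|` and the reflection formula bound the
kernel by a multiple of `1 / cosh (πτ / 2)`, so that it is integrable in `τ` and Fourier inversion
applies (`integral_cos_mul_lebedevSkalskayaKernel`).
-/

namespace LebedevSkalskaya

open MeasureTheory Set Filter Topology FourierTransform

/-! ### The Kummer function `₁F₁(1; 3/2; -t)` -/

/-- Integrate the derivative of `s (1 - s²) ^ (n + 1)`, which vanishes at both endpoints. -/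
lemma integral_one_sub_sq_pow_succ (n : ℕ) :
    (2 * (n : ℝ) + 3) * ∫ s in (0 : ℝ)..1, (1 - s ^ 2) ^ (n + 1) =
      (2 * (n : ℝ) + 2) * ∫ s in (0 : ℝ)..1, (1 - s ^ 2) ^ n := by
  have hd : ∀ s ∈ uIcc (0 : ℝ) 1, HasDerivAt (fun s : ℝ => s * (1 - s ^ 2) ^ (n + 1))
      ((2 * n + 3) * (1 - s ^ 2) ^ (n + 1) - (2 * n + 2) * (1 - s ^ 2) ^ n) s := by
    intro s _
    have h := (hasDerivAt_id s).mul ((((hasDerivAt_id s).pow 2).const_sub 1).pow (n + 1))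
    refine h.congr_deriv ?_
    simp
    ring
  have h := intervalIntegral.integral_eq_sub_of_hasDerivAt hd
    (Continuous.intervalIntegrable (by fun_prop) _ _)
  rw [intervalIntegral.integral_sub (Continuous.intervalIntegrable (by fun_prop) _ _)
    (Continuous.intervalIntegrable (by fun_prop) _ _), intervalIntegral.integral_const_mul,
    intervalIntegral.integral_const_mul] at h
  simp at h
  linarith

lemma integral_one_sub_sq_pow (n : ℕ) :
    ∫ s in (0 : ℝ)..1, (1 - s ^ 2) ^ n =
      (n.factorial : ℝ) / (ascPochhammer ℝ n).eval (3 / 2) := by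
  induction n with
  | zero => simp
  | succ n ih =>
    have h := integral_one_sub_sq_pow_succ n
    have hp : 0 < (ascPochhammer ℝ n).eval (3 / 2) := ascPochhammer_pos n _ (by norm_num)
    rw [ih] at h
    rw [ascPochhammer_succ_eval, Nat.factorial_succ, eq_div_iff (by positivity)]
    field_simp at h
    push_cast
    linear_combination h / 2

lemma hasSum_kummerF_one_terms (t : ℝ) :
    HasSum (fun n : ℕ => (ascPochhammer ℝ n).eval 1 / (ascPochhammer ℝ n).eval (3 / 2) *
      ((-t) ^ n / (n.factorial : ℝ))) (∫ s in (0 : ℝ)..1, Real.exp (-(t * (1 - s ^ 2)))) := by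
  have h := intervalIntegral.hasSum_integral_of_dominated_convergence (a := 0) (b := 1)
    (μ := volume) (F := fun (n : ℕ) (s : ℝ) => (-t) ^ n / (n.factorial : ℝ) * (1 - s ^ 2) ^ n)
    (f := fun s => Real.exp (-(t * (1 - s ^ 2))))
    (fun (n : ℕ) _ => |t| ^ n / (n.factorial : ℝ))
    (fun n => (by fun_prop : Continuous _).aestronglyMeasurable)
    (fun n => ae_of_all _ fun s hs => ?_)
    (ae_of_all _ fun s hs => Real.summable_pow_div_factorial _)
    (by simp) (ae_of_all _ fun s hs => ?_)
  · refine Eq.subst (motive := fun f => HasSum f _) (funext fun n => ?_) h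
    rw [intervalIntegral.integral_const_mul, integral_one_sub_sq_pow, ascPochhammer_eval_one]
    ring
  · rw [uIoc_of_le zero_le_one] at hs
    have h1 : |1 - s ^ 2| ≤ 1 := by
      rw [abs_le]; constructor <;> nlinarith [hs.1, hs.2]
    rw [norm_mul, norm_div, norm_pow, norm_pow, Real.norm_natCast, Real.norm_eq_abs,
      Real.norm_eq_abs, abs_neg]
    exact mul_le_of_le_one_right (by positivity) (pow_le_one₀ (abs_nonneg _) h1)
  · have := NormedSpace.expSeries_div_hasSum_exp (-(t * (1 - s ^ 2)))
    rw [← Real.exp_eq_exp_ℝ] at this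
    refine Eq.subst (motive := fun f => HasSum f _) (funext fun n => ?_) this
    rw [← neg_mul, mul_pow]
    ring

/-- Euler's integral `₁F₁(1; 3/2; -t) = ∫₀¹ exp (-t (1 - s²)) ds`. -/
lemma kummerF_eq_integral (t : ℝ) :
    kummerF (1 : ℝ) (3 / 2) (-t) = ∫ s in (0 : ℝ)..1, Real.exp (-(t * (1 - s ^ 2))) :=
  (hasSum_kummerF_one_terms t).tsum_eq

lemma kummerF_nonneg (t : ℝ) : 0 ≤ kummerF (1 : ℝ) (3 / 2) (-t) := by
  rw [kummerF_eq_integral]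
  exact intervalIntegral.integral_nonneg zero_le_one fun s _ => (Real.exp_pos _).le

/-- Since `1 - s² ≥ 1 - s` on `[0, 1]`, Euler's integral is at most `∫₀¹ exp (-t (1 - s)) ds`. -/
lemma kummerF_le_inv {t : ℝ} (ht : 0 < t) : kummerF (1 : ℝ) (3 / 2) (-t) ≤ 1 / t := by
  rw [kummerF_eq_integral]
  have hd : ∀ s ∈ uIcc (0 : ℝ) 1, HasDerivAt (fun s : ℝ => Real.exp (-(t * (1 - s))) / t)
      (Real.exp (-(t * (1 - s)))) s := by
    intro s _
    have h := (((((hasDerivAt_id s).const_sub 1).const_mul t).neg).exp).div_const t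
    refine h.congr_deriv ?_
    simp [ht.ne']
  have h := intervalIntegral.integral_eq_sub_of_hasDerivAt hd
    (Continuous.intervalIntegrable (by fun_prop) _ _)
  calc _ ≤ ∫ s in (0 : ℝ)..1, Real.exp (-(t * (1 - s))) := by
        refine intervalIntegral.integral_mono_on zero_le_one
          (Continuous.intervalIntegrable (by fun_prop) _ _)
          (Continuous.intervalIntegrable (by fun_prop) _ _) fun s hs => ?_
        apply Real.exp_le_exp.2
        have : s ^ 2 ≤ s := by nlinarith [hs.1, hs.2]
        nlinarith
    _ ≤ 1 / t := by
        rw [h]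
        simp
        positivity

lemma continuous_kummerF : Continuous fun t : ℝ => kummerF (1 : ℝ) (3 / 2) (-t) := by
  simp_rw [kummerF_eq_integral]
  exact intervalIntegral.continuous_parametric_intervalIntegral_of_continuous' (by fun_prop) _ _

lemma integrableOn_rpow_mul_exp {a r : ℝ} (ha : 0 < a) (hr : 0 < r) :
    IntegrableOn (fun x => x ^ (a - 1) * Real.exp (-(r * x))) (Ioi (0 : ℝ)) := by
  -- a nonzero Bochner integral certifies integrability
  refine not_imp_comm.1 integral_undef ?_
  rw [Real.integral_rpow_mul_exp_neg_mul_Ioi ha hr]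
  exact (mul_pos (Real.rpow_pos_of_pos (by positivity) _) (Real.Gamma_pos_of_pos ha)).ne'

lemma integral_sqrt_mul_exp {b : ℝ} (hb : 0 < b) :
    ∫ x in Ioi (0 : ℝ), √x * Real.exp (-(b * x)) = √Real.pi / 2 / (b * √b) := by
  have h := Real.integral_rpow_mul_exp_neg_mul_Ioi (a := 3 / 2) (r := b) (by norm_num) hb
  have h3 : Real.Gamma (3 / 2) = √Real.pi / 2 := by
    rw [show (3 / 2 : ℝ) = 1 / 2 + 1 by norm_num, Real.Gamma_add_one (by norm_num),
      Real.Gamma_one_half_eq]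
    ring
  rw [h3, show (3 / 2 : ℝ) - 1 = 1 / 2 by norm_num] at h
  simp_rw [Real.sqrt_eq_rpow] at h ⊢
  rw [h, show (3 / 2 : ℝ) = 1 + 1 / 2 by norm_num, Real.rpow_add (by positivity), Real.rpow_one,
    Real.div_rpow zero_le_one hb.le, Real.one_rpow]
  field_simp

lemma integrableOn_sqrt_mul_exp {b : ℝ} (hb : 0 < b) :
    IntegrableOn (fun x => √x * Real.exp (-(b * x))) (Ioi (0 : ℝ)) := by
  have h := integrableOn_rpow_mul_exp (a := 3 / 2) (r := b) (by norm_num) hb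
  rw [show (3 / 2 : ℝ) - 1 = 1 / 2 by norm_num] at h
  simpa only [Real.sqrt_eq_rpow] using h

/-- The Laplace transform of `x ↦ √x ₁F₁(1; 3/2; -a x)`, by Fubini in Euler's integral. -/
lemma integral_exp_mul_sqrt_mul_kummerF {p a : ℝ} (hp : 0 < p) (ha : 0 < a) :
    ∫ x in Ioi (0 : ℝ), Real.exp (-(p * x)) * (√x * kummerF (1 : ℝ) (3 / 2) (-(a * x))) =
      √Real.pi / 2 / (√p * (p + a)) := by
  have hb : ∀ s ∈ Icc (0 : ℝ) 1, 0 < p + a * (1 - s ^ 2) := by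
    intro s hs
    have : 0 ≤ 1 - s ^ 2 := by nlinarith [hs.1, hs.2]
    positivity
  have hint : Integrable (Function.uncurry fun (x s : ℝ) =>
      √x * Real.exp (-((p + a * (1 - s ^ 2)) * x)))
      ((volume.restrict (Ioi 0)).prod (volume.restrict (Ioc 0 1))) := by
    refine Integrable.mono' (g := fun z : ℝ × ℝ => √z.1 * Real.exp (-(p * z.1)) * 1)
      (Integrable.mul_prod (integrableOn_sqrt_mul_exp hp) (integrable_const 1))
      (by fun_prop) ?_
    rw [Measure.prod_restrict]
    filter_upwards [ae_restrict_mem (measurableSet_Ioi.prod measurableSet_Ioc)] with z hz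
    obtain ⟨h1, h2⟩ := hz
    have h1' : 0 < z.1 := h1
    have h3 : 0 ≤ 1 - z.2 ^ 2 := by nlinarith [h2.1, h2.2]
    simp only [Function.uncurry, norm_mul, Real.norm_eq_abs, abs_of_nonneg (Real.sqrt_nonneg _),
      Real.abs_exp, mul_one]
    refine mul_le_mul_of_nonneg_left (Real.exp_le_exp.2 ?_) (Real.sqrt_nonneg _)
    have : 0 ≤ a * (1 - z.2 ^ 2) * z.1 := by positivity
    linarith
  -- an antiderivative of `(p + a (1 - s²)) ^ (-3/2)`
  have hd : ∀ s ∈ uIcc (0 : ℝ) 1, HasDerivAt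
      (fun s : ℝ => s / ((p + a) * √(p + a * (1 - s ^ 2))))
      (1 / ((p + a * (1 - s ^ 2)) * √(p + a * (1 - s ^ 2)))) s := by
    intro s hs
    rw [uIcc_of_le zero_le_one] at hs
    have h0 := hb s hs
    have h1 : HasDerivAt (fun s : ℝ => p + a * (1 - s ^ 2)) (a * (-(2 * s))) s := by
      have := ((((hasDerivAt_id s).pow 2).const_sub 1).const_mul a).const_add p
      exact this.congr_deriv (by simp)
    have h2 := (hasDerivAt_id s).div ((h1.sqrt h0.ne').const_mul (p + a)) (by positivity)
    refine h2.congr_deriv ?_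
    have h3 : √(p + a * (1 - s ^ 2)) ^ 2 = p + a * (1 - s ^ 2) := Real.sq_sqrt h0.le
    have h4 : 0 < √(p + a * (1 - s ^ 2)) := Real.sqrt_pos.2 h0
    set w := √(p + a * (1 - s ^ 2))
    rw [← h3]
    simp only [id]
    field_simp
    linear_combination h3
  calc _ = ∫ x in Ioi (0 : ℝ), ∫ s in Ioc (0 : ℝ) 1,
        √x * Real.exp (-((p + a * (1 - s ^ 2)) * x)) := by
        refine integral_congr_ae (ae_of_all _ fun x => ?_)
        simp only
        rw [kummerF_eq_integral, intervalIntegral.integral_of_le zero_le_one, ← mul_assoc,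
          ← integral_const_mul]
        refine integral_congr_ae (ae_of_all _ fun s => ?_)
        simp only
        rw [mul_right_comm, ← Real.exp_add, mul_comm]
        ring_nf
    _ = ∫ s in Ioc (0 : ℝ) 1, ∫ x in Ioi (0 : ℝ),
        √x * Real.exp (-((p + a * (1 - s ^ 2)) * x)) := integral_integral_swap hint
    _ = ∫ s in (0 : ℝ)..1, √Real.pi / 2 * (1 /
          ((p + a * (1 - s ^ 2)) * √(p + a * (1 - s ^ 2)))) := by
        rw [intervalIntegral.integral_of_le zero_le_one]
        refine setIntegral_congr_fun measurableSet_Ioc fun s hs => ?_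
        rw [integral_sqrt_mul_exp (hb s ⟨hs.1.le, hs.2⟩)]
        ring
    _ = _ := by
        rw [intervalIntegral.integral_const_mul,
          intervalIntegral.integral_eq_sub_of_hasDerivAt hd]
        · simp
          field_simp
        · refine ContinuousOn.intervalIntegrable ?_
          rw [uIcc_of_le zero_le_one]
          refine ContinuousOn.div (by fun_prop) (by fun_prop) fun s hs => ?_
          have := hb s hs
          positivity

/-! ### Uniqueness for the Laplace transform -/

/-- By Weierstrass approximation, an integrable function on `(0, ∞)` whose Laplace transform
vanishes at the natural numbers is orthogonal to every continuous function of `exp (-x)`. -/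
lemma integral_comp_exp_neg_mul_eq_zero {F : ℝ → ℝ} (hF : IntegrableOn F (Ioi 0))
    (h : ∀ n : ℕ, ∫ x in Ioi (0 : ℝ), Real.exp (-(n * x)) * F x = 0)
    {φ : ℝ → ℝ} (hφ : ContinuousOn φ (Icc 0 1)) :
    ∫ x in Ioi (0 : ℝ), φ (Real.exp (-x)) * F x = 0 := by
  have hE : ∀ x ∈ Ioi (0 : ℝ), Real.exp (-x) ∈ Icc (0 : ℝ) 1 := fun x hx =>
    ⟨(Real.exp_pos _).le, Real.exp_le_one_iff.2 (by linarith [mem_Ioi.1 hx])⟩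
  have hpint : ∀ n : ℕ, IntegrableOn (fun x => Real.exp (-x) ^ n * F x) (Ioi 0) := fun n => by
    refine hF.bdd_mul (c := 1) (by fun_prop) ?_
    filter_upwards [ae_restrict_mem measurableSet_Ioi] with x hx
    rw [norm_pow, Real.norm_eq_abs, Real.abs_exp]
    exact pow_le_one₀ (hE x hx).1 (hE x hx).2
  have hpoly : ∀ P : Polynomial ℝ, IntegrableOn (fun x => P.eval (Real.exp (-x)) * F x) (Ioi 0) ∧
      ∫ x in Ioi (0 : ℝ), P.eval (Real.exp (-x)) * F x = 0 := by
    intro P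
    simp_rw [Polynomial.eval_eq_sum_range, Finset.sum_mul, mul_assoc]
    constructor
    · exact integrable_finsetSum _ fun i _ => (hpint i).const_mul _
    · rw [integral_finsetSum _ fun i _ => (hpint i).const_mul _]
      refine Finset.sum_eq_zero fun i _ => ?_
      rw [integral_const_mul]
      have := h i
      simp_rw [← mul_neg, Real.exp_nat_mul] at this
      rw [this, mul_zero]
  have hφm : AEStronglyMeasurable (fun x => φ (Real.exp (-x))) (volume.restrict (Ioi (0 : ℝ))) :=
    (hφ.comp (by fun_prop) hE).aestronglyMeasurable measurableSet_Ioi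
  obtain ⟨C, hC⟩ := isCompact_Icc.exists_bound_of_continuousOn hφ
  have hφint : IntegrableOn (fun x => φ (Real.exp (-x)) * F x) (Ioi 0) := by
    refine hF.bdd_mul (c := C) hφm ?_
    filter_upwards [ae_restrict_mem measurableSet_Ioi] with x hx using hC _ (hE x hx)
  set A := ∫ x in Ioi (0 : ℝ), |F x|
  have hA : 0 ≤ A := integral_nonneg fun x => abs_nonneg _
  have key : ∀ ε > 0, |∫ x in Ioi (0 : ℝ), φ (Real.exp (-x)) * F x| ≤ ε * A := by
    intro ε hε
    obtain ⟨P, hP⟩ := exists_polynomial_near_of_continuousOn 0 1 φ hφ ε hε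
    have h1 : ∫ x in Ioi (0 : ℝ), φ (Real.exp (-x)) * F x =
        ∫ x in Ioi (0 : ℝ), (φ (Real.exp (-x)) * F x - P.eval (Real.exp (-x)) * F x) := by
      rw [integral_sub hφint (hpoly P).1, (hpoly P).2, sub_zero]
    rw [h1, ← integral_const_mul, ← Real.norm_eq_abs]
    refine norm_integral_le_of_norm_le (hF.abs.const_mul ε) ?_
    filter_upwards [ae_restrict_mem measurableSet_Ioi] with x hx
    rw [← sub_mul, norm_mul, Real.norm_eq_abs, Real.norm_eq_abs, abs_sub_comm]
    exact mul_le_mul_of_nonneg_right (hP _ (hE x hx)).le (abs_nonneg _)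
  by_contra hne
  have hpos := abs_pos.2 hne
  set B := |∫ x in Ioi (0 : ℝ), φ (Real.exp (-x)) * F x|
  have := key (B / (2 * (A + 1))) (by positivity)
  have h2 : B / (2 * (A + 1)) * A ≤ B / 2 := by
    rw [div_mul_eq_mul_div, div_le_div_iff₀ (by positivity) (by positivity)]
    nlinarith
  linarith

/-- A function on `(0, ∞)` is determined almost everywhere by the values of its Laplace transform
at the natural numbers. -/
lemma ae_eq_zero_of_laplace_nat_eq_zero {F : ℝ → ℝ} (hF : IntegrableOn F (Ioi 0))
    (h : ∀ n : ℕ, ∫ x in Ioi (0 : ℝ), Real.exp (-(n * x)) * F x = 0) :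
    ∀ᵐ x, x ∈ Ioi (0 : ℝ) → F x = 0 := by
  refine isOpen_Ioi.ae_eq_zero_of_integral_contDiff_smul_eq_zero hF.locallyIntegrableOn
    fun g hg hgc hgs => ?_
  -- `g x = φ (exp (-x))` with `φ t = g (-log t)`; `φ` vanishes near `0` as `g` has compact support.
  have hcont : ContinuousOn (fun t => g (-Real.log t)) (Icc 0 1) := by
    intro t ht
    refine ContinuousAt.continuousWithinAt ?_
    rcases eq_or_ne t 0 with rfl | h0
    · have hz : (fun t => g (-Real.log t)) =ᶠ[𝓝 0] fun _ => 0 := by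
        have h1 : ∀ᶠ t in 𝓝[≠] (0 : ℝ), g (-Real.log t) = 0 := by
          have h2 := tendsto_neg_atBot_atTop.comp Real.tendsto_log_nhdsNE_zero
          have h3 : ∀ᶠ x in atTop, g x = 0 := by
            have := hasCompactSupport_iff_eventuallyEq.1 hgc
            rw [coclosedCompact_eq_cocompact] at this
            exact this.filter_mono atTop_le_cocompact
          exact h2.eventually h3
        rw [eventually_nhdsWithin_iff] at h1
        filter_upwards [h1] with t ht
        rcases eq_or_ne t 0 with rfl | h0
        · have : (0 : ℝ) ∉ tsupport g := fun hh => lt_irrefl _ (mem_Ioi.1 (hgs hh))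
          simpa using image_eq_zero_of_notMem_tsupport this
        · exact ht h0
      exact continuousAt_const.congr hz.symm
    · have := hg.continuous
      exact this.continuousAt.comp (Real.continuousAt_log h0).neg
  have h1 := integral_comp_exp_neg_mul_eq_zero hF h hcont
  simp only [Real.log_exp, neg_neg] at h1
  rw [← h1]
  symm
  refine setIntegral_eq_integral_of_forall_compl_eq_zero fun x hx => ?_
  have : x ∉ tsupport g := fun hh => hx (hgs hh)
  simp [image_eq_zero_of_notMem_tsupport this]

/-- A continuous function on `(0, ∞)` whose Laplace transform vanishes on a half-line is zero. -/
lemma eq_zero_of_laplace_eq_zero {F : ℝ → ℝ} (hF : ContinuousOn F (Ioi 0)) (p₀ : ℝ)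
    (hint : IntegrableOn (fun x => Real.exp (-(p₀ * x)) * F x) (Ioi 0))
    (h : ∀ p ≥ p₀, ∫ x in Ioi (0 : ℝ), Real.exp (-(p * x)) * F x = 0) {x : ℝ} (hx : 0 < x) :
    F x = 0 := by
  have h1 := ae_eq_zero_of_laplace_nat_eq_zero
    (F := fun x => Real.exp (-(p₀ * x)) * F x) hint fun n => by
    have hn := h (n + p₀) (by have : (0 : ℝ) ≤ n := n.cast_nonneg; linarith)
    refine Eq.trans ?_ hn
    refine integral_congr_ae (ae_of_all _ fun x => ?_)
    simp only
    rw [← mul_assoc, ← Real.exp_add]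
    ring_nf
  have h2 : (fun x => Real.exp (-(p₀ * x)) * F x) =ᵐ[volume.restrict (Ioi 0)] fun _ => 0 :=
    (ae_restrict_iff' measurableSet_Ioi).2 h1
  have h3 := Measure.eqOn_open_of_ae_eq h2 isOpen_Ioi
    (ContinuousOn.mul (by fun_prop) hF) continuousOn_const hx
  simpa [(Real.exp_pos _).ne'] using h3

/-! ### A binomial sum -/

lemma ascPochhammer_eval_mul_eval_add (a : ℂ) (m n : ℕ) :
    (ascPochhammer ℂ m).eval a * (ascPochhammer ℂ n).eval (a + m) =
      (ascPochhammer ℂ (m + n)).eval a := by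
  have h := congrArg (Polynomial.eval a) (ascPochhammer_mul ℂ m n)
  simpa using h

lemma norm_ascPochhammer_eval_le {a : ℂ} {m : ℕ} (h : ‖a‖ ≤ m + 1) (n : ℕ) :
    ‖(ascPochhammer ℂ n).eval a‖ ≤ n.factorial * (m + n).choose n := by
  have h1 : ‖(ascPochhammer ℂ n).eval a‖ ≤ ((m + 1).ascFactorial n : ℝ) := by
    induction n with
    | zero => simp
    | succ n ih =>
      rw [ascPochhammer_succ_eval, norm_mul, Nat.ascFactorial_succ, mul_comm]
      push_cast
      refine mul_le_mul ((norm_add_le _ _).trans ?_) ih (norm_nonneg _) (by positivity)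
      simpa using h
  rw [Nat.ascFactorial_eq_factorial_mul_choose] at h1
  exact_mod_cast h1

lemma factorial_le_norm_ascPochhammer_eval {a : ℂ} (ha : 1 ≤ a.re) (n : ℕ) :
    (n.factorial : ℝ) ≤ ‖(ascPochhammer ℂ n).eval a‖ := by
  induction n with
  | zero => simp
  | succ n ih =>
    rw [ascPochhammer_succ_eval, norm_mul, Nat.factorial_succ, mul_comm]
    push_cast
    refine mul_le_mul ih ?_ (by positivity) (norm_nonneg _)
    refine le_trans ?_ (Complex.re_le_norm _)
    simp
    linarith

lemma Gamma_add_natCast {a : ℂ} (ha : 0 < a.re) (n : ℕ) :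
    Complex.Gamma (a + n) = (ascPochhammer ℂ n).eval a * Complex.Gamma a := by
  induction n with
  | zero => simp
  | succ n ih =>
    have h0 : a + n ≠ 0 := fun h => by
      have := congrArg Complex.re h
      simp at this
      have h2 : (0 : ℝ) ≤ n := Nat.cast_nonneg n
      linarith
    rw [Nat.cast_succ, ← add_assoc, Complex.Gamma_add_one _ h0, ih, ascPochhammer_succ_eval]
    ring

/-- The `n`-th forward difference of the monic polynomial `(X)ₙ` of degree `n` is `n!`. -/
lemma sum_neg_one_pow_mul_choose_mul_ascPochhammer (a : ℂ) (n : ℕ) :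
    ∑ k ∈ Finset.range (n + 1), (-1) ^ (n - k) * (n.choose k : ℂ) *
      (ascPochhammer ℂ n).eval (a + k) = n.factorial := by
  have h := fwdDiff_iter_eq_sum_shift (1 : ℂ) (ascPochhammer ℂ n).eval n a
  have h2 := congrFun (ascPochhammer ℂ n).fwdDiff_iter_degree_eq_factorial a
  rw [ascPochhammer_natDegree, (monic_ascPochhammer ℂ n).leadingCoeff] at h2
  rw [h2] at h
  simpa using h.symm

/-- The binomial series of `(1 + r) ^ (-a)`. -/
lemma hasSum_one_add_cpow_neg (a : ℂ) {r : ℝ} (h0 : 0 ≤ r) (h1 : r < 1) :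
    HasSum (fun j : ℕ => (ascPochhammer ℂ j).eval a / j.factorial * (-1) ^ j * (r : ℂ) ^ j)
      ((1 + (r : ℂ)) ^ (-a)) := by
  have h := (Complex.one_div_one_sub_cpow_hasFPowerSeriesOnBall_zero a).hasSum (y := -(r : ℂ))
    (by simp [abs_of_nonneg h0, Metric.mem_eball, edist_zero_right, enorm_eq_nnnorm,
      ← NNReal.coe_lt_coe, h1])
  simp only [zero_add, sub_neg_eq_add, ← Complex.cpow_neg, one_div] at h
  refine Eq.subst (motive := fun f => HasSum f _) (funext fun j => ?_) h
  have hj : (j.factorial : ℂ) ≠ 0 := Nat.cast_ne_zero.2 j.factorial_ne_zero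
  have := Ring.factorial_nsmul_multichoose_eq_ascPochhammer a j
  rw [Ring.multichoose_eq, nsmul_eq_mul, Polynomial.ascPochhammer_smeval_eq_eval] at this
  rw [FormalMultilinearSeries.ofScalars_apply_eq, smul_eq_mul, ← this,
    mul_div_cancel_left₀ _ hj, neg_pow]
  ring

/-- Expand `(1 + r) ^ (-(a + 2k))` by the binomial series. The double series converges absolutely
for `8 r < 1`, and its part of degree `n` in `r` is `1 / n!` times an `n`-th forward difference of
`(X)ₙ`, hence equal to `r ^ n`. -/
lemma hasSum_ascPochhammer_mul_cpow {a : ℂ} {r : ℝ} (h0 : 0 ≤ r) (h1 : r < 1 / 8) :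
    HasSum (fun k : ℕ => (ascPochhammer ℂ k).eval (a + k) / k.factorial * (r : ℂ) ^ k *
      (1 + (r : ℂ)) ^ (-(a + 2 * k))) (1 / (1 - (r : ℂ))) := by
  obtain ⟨m, hm⟩ := exists_nat_ge (‖a‖ - 1)
  set t : ℕ × ℕ → ℂ := fun z => (ascPochhammer ℂ (z.1 + z.2)).eval (a + z.1) /
    (z.1.factorial * z.2.factorial) * (-1) ^ z.2 * (r : ℂ) ^ (z.1 + z.2) with ht
  have hbound : ∀ z, ‖t z‖ ≤ 2 ^ m * ((8 * r) ^ z.1 * (8 * r) ^ z.2) := by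
    rintro ⟨k, j⟩
    have e1 := norm_ascPochhammer_eval_le (a := a + k) (m := m + k)
      ((norm_add_le _ _).trans (by simp; linarith)) (k + j)
    have e2 : ((k + j).factorial : ℝ) = (k + j).choose k * (k.factorial * j.factorial) := by
      have := Nat.choose_mul_factorial_mul_factorial (Nat.le_add_right k j)
      rw [Nat.add_sub_cancel_left] at this
      rw [← mul_assoc]
      exact_mod_cast this.symm
    have e3 : (((k + j).choose k : ℕ) : ℝ) ≤ 2 ^ (k + j) := by
      exact_mod_cast Nat.choose_le_two_pow _ _
    have e4 : (((m + k + (k + j)).choose (k + j) : ℕ) : ℝ) ≤ 2 ^ (m + 2 * (k + j)) := by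
      have h1 : (m + k + (k + j)).choose (k + j) ≤ 2 ^ (m + k + (k + j)) :=
        Nat.choose_le_two_pow _ _
      have h2 : 2 ^ (m + k + (k + j)) ≤ 2 ^ (m + 2 * (k + j)) :=
        Nat.pow_le_pow_right (by norm_num) (by omega)
      exact_mod_cast h1.trans h2
    have hfac : (0 : ℝ) < k.factorial * j.factorial := by positivity
    simp only [ht, norm_mul, norm_div, norm_pow, norm_neg, norm_one, one_pow, mul_one,
      RCLike.norm_natCast, Complex.norm_real, Real.norm_eq_abs, abs_of_nonneg h0]
    rw [e2] at e1
    calc _ ≤ ((k + j).choose k * (k.factorial * j.factorial) *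
          (m + k + (k + j)).choose (k + j)) / (k.factorial * j.factorial) * r ^ (k + j) := by
          gcongr
      _ = (k + j).choose k * (m + k + (k + j)).choose (k + j) * r ^ (k + j) := by
          field_simp
      _ ≤ 2 ^ (k + j) * 2 ^ (m + 2 * (k + j)) * r ^ (k + j) := by gcongr
      _ = _ := by
          rw [← pow_add (8 * r), mul_pow, show (8 : ℝ) = 2 ^ 3 by norm_num, ← pow_mul]
          ring
  have hsum : Summable t := by
    have hg : Summable fun k : ℕ => (8 * r) ^ k :=
      summable_geometric_of_lt_one (by positivity) (by linarith)
    exact Summable.of_norm_bounded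
      ((hg.mul_of_nonneg hg (fun _ => by positivity) fun _ => by positivity).mul_left _) hbound
  have hrows : ∀ k : ℕ, HasSum (fun j => t (k, j))
      ((ascPochhammer ℂ k).eval (a + k) / k.factorial * (r : ℂ) ^ k *
        (1 + (r : ℂ)) ^ (-(a + 2 * k))) := by
    intro k
    have h := (hasSum_one_add_cpow_neg (a + 2 * k) h0 (by linarith)).mul_left
      ((ascPochhammer ℂ k).eval (a + k) / k.factorial * (r : ℂ) ^ k)
    refine Eq.subst (motive := fun f => HasSum f _) (funext fun j => ?_) h
    simp only [ht]
    rw [← ascPochhammer_eval_mul_eval_add, pow_add, show a + 2 * (k : ℂ) = a + k + k by ring]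
    ring
  have hdiag : ∀ n : ℕ, ∑ z ∈ Finset.HasAntidiagonal.antidiagonal n, t z = (r : ℂ) ^ n := by
    intro n
    have hn : (n.factorial : ℂ) ≠ 0 := Nat.cast_ne_zero.2 n.factorial_ne_zero
    rw [Finset.Nat.sum_antidiagonal_eq_sum_range_succ_mk]
    calc _ = ∑ k ∈ Finset.range (n + 1), (r : ℂ) ^ n / n.factorial *
          ((-1) ^ (n - k) * (n.choose k : ℂ) * (ascPochhammer ℂ n).eval (a + k)) := by
          refine Finset.sum_congr rfl fun k hk => ?_
          have hk' : k ≤ n := Nat.lt_succ_iff.1 (Finset.mem_range.1 hk)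
          simp only [ht]
          rw [Nat.add_sub_cancel' hk', Nat.cast_choose ℂ hk']
          field_simp
      _ = _ := by
          rw [← Finset.mul_sum, sum_neg_one_pow_mul_choose_mul_ascPochhammer]
          field_simp
  have hgeom : HasSum (fun n : ℕ => (r : ℂ) ^ n) (∑' z, t z) := by
    have h := (Finset.HasAntidiagonal.sigmaAntidiagonalEquivProd (A := ℕ)).hasSum_iff.2 hsum.hasSum
    have h2 := h.sigma fun n => hasSum_fintype _
    refine Eq.subst (motive := fun f => HasSum f _) (funext fun n => ?_) h2
    rw [← hdiag n]
    exact Finset.sum_coe_sort (Finset.HasAntidiagonal.antidiagonal n) t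
  have hval : ∑' z, t z = 1 / (1 - (r : ℂ)) := by
    rw [one_div]
    refine hgeom.unique (hasSum_geometric_of_norm_lt_one ?_)
    rw [Complex.norm_real, Real.norm_eq_abs, abs_of_nonneg h0]
    linarith
  rw [← hval]
  exact hsum.hasSum.prod_fiberwise hrows

/-! ### The modified Bessel function of imaginary order -/

/-- The `k`-th term of the series of `I_{iτ}(z)`. -/
noncomputable def besselTerm (τ z : ℝ) (k : ℕ) : ℂ :=
  ((z : ℂ) / 2) ^ (2 * (k : ℂ) + Complex.I * τ) /
    ((k.factorial : ℂ) * Complex.Gamma ((k : ℂ) + Complex.I * τ + 1))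

lemma besselI_eq_tsum (τ z : ℝ) : besselI (Complex.I * τ) z = ∑' k, besselTerm τ z k := rfl

lemma Gamma_add_I_mul_add_one (τ : ℝ) (k : ℕ) :
    Complex.Gamma ((k : ℂ) + Complex.I * τ + 1) =
      (ascPochhammer ℂ k).eval (1 + Complex.I * τ) * Complex.Gamma (1 + Complex.I * τ) := by
  rw [← Gamma_add_natCast (by simp)]
  ring_nf

lemma Gamma_one_add_I_mul_ne_zero (τ : ℝ) : Complex.Gamma (1 + Complex.I * τ) ≠ 0 :=
  Complex.Gamma_ne_zero_of_re_pos (by simp)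

/-- The terms of `I_{iτ}(z)` are dominated by those of `cosh z`, because `|(1 + iτ)ₖ| ≥ k!` and
`(2k)! ≤ 4 ^ k k! ^ 2`. -/
lemma norm_besselTerm_le (τ : ℝ) {z : ℝ} (hz : 0 < z) (k : ℕ) :
    ‖besselTerm τ z k‖ ≤
      ‖Complex.Gamma (1 + Complex.I * τ)‖⁻¹ * (z ^ (2 * k) / ((2 * k).factorial : ℝ)) := by
  have hG : 0 < ‖Complex.Gamma (1 + Complex.I * τ)‖ :=
    norm_pos_iff.2 (Gamma_one_add_I_mul_ne_zero τ)
  have h1 : ‖((z : ℂ) / 2) ^ (2 * (k : ℂ) + Complex.I * τ)‖ = (z / 2) ^ (2 * k) := by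
    have := Complex.norm_cpow_eq_rpow_re_of_pos (half_pos hz) (2 * (k : ℂ) + Complex.I * τ)
    push_cast at this
    rw [this, ← Real.rpow_natCast]
    simp
  have h2 := factorial_le_norm_ascPochhammer_eval (a := 1 + Complex.I * τ) (by simp) k
  have h3 : ((2 * k).factorial : ℝ) ≤ 4 ^ k * (k.factorial * k.factorial) := by
    have e := Nat.choose_mul_factorial_mul_factorial (show k ≤ 2 * k by omega)
    rw [show 2 * k - k = k by omega] at e
    have e2 : (2 * k).choose k ≤ 2 ^ (2 * k) := Nat.choose_le_two_pow _ _
    rw [pow_mul] at e2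
    have e3 : (2 * k).factorial ≤ 4 ^ k * (k.factorial * k.factorial) := by
      rw [← e, mul_assoc]
      exact Nat.mul_le_mul_right _ e2
    exact_mod_cast e3
  rw [besselTerm, Gamma_add_I_mul_add_one, norm_div, norm_mul, norm_mul, h1, RCLike.norm_natCast]
  calc _ ≤ (z / 2) ^ (2 * k) /
        (k.factorial * (k.factorial * ‖Complex.Gamma (1 + Complex.I * τ)‖)) := by gcongr
    _ = ‖Complex.Gamma (1 + Complex.I * τ)‖⁻¹ *
        (z ^ (2 * k) / (4 ^ k * (k.factorial * k.factorial))) := by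
        rw [div_pow, pow_mul 2]
        field_simp
        norm_num
    _ ≤ _ := by gcongr

lemma norm_besselI_le (τ : ℝ) {z : ℝ} (hz : 0 < z) :
    ‖besselI (Complex.I * τ) z‖ ≤ ‖Complex.Gamma (1 + Complex.I * τ)‖⁻¹ * Real.cosh z := by
  rw [besselI_eq_tsum]
  exact tsum_of_norm_bounded (z.hasSum_cosh.mul_left _) (norm_besselTerm_le τ hz)

/-- From the reflection formula, `|Γ(1 + iτ)|² = πτ / sinh (πτ)`, and `sinh x ≤ x cosh x`. -/
lemma inv_norm_Gamma_sq_le (τ : ℝ) :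
    ‖Complex.Gamma (1 + Complex.I * τ)‖⁻¹ ^ 2 ≤ Real.cosh (Real.pi * τ) := by
  rcases eq_or_ne τ 0 with rfl | h0
  · simp
  have hpt : Real.pi * τ ≠ 0 := mul_ne_zero Real.pi_ne_zero h0
  have hsinh : Real.sinh (Real.pi * τ) ≠ 0 := by rwa [Ne, Real.sinh_eq_zero]
  have hI : Complex.I * (τ : ℂ) ≠ 0 := mul_ne_zero Complex.I_ne_zero (by exact_mod_cast h0)
  have e1 : Complex.Gamma (1 + Complex.I * τ) = Complex.I * τ * Complex.Gamma (Complex.I * τ) := by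
    rw [add_comm, Complex.Gamma_add_one _ hI]
  have e2 : (starRingEnd ℂ) (Complex.Gamma (1 + Complex.I * τ)) =
      Complex.Gamma (1 - Complex.I * τ) := by
    rw [← Complex.Gamma_conj]
    simp [sub_eq_add_neg]
  have e3 := Complex.Gamma_mul_Gamma_one_sub (Complex.I * τ)
  have e4 : Complex.sin (Real.pi * (Complex.I * τ)) = Real.sinh (Real.pi * τ) * Complex.I := by
    rw [show (Real.pi : ℂ) * (Complex.I * τ) = ((Real.pi * τ : ℝ) : ℂ) * Complex.I by
      push_cast; ring, Complex.sin_mul_I, Complex.ofReal_sinh]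
  have e5 : ‖Complex.Gamma (1 + Complex.I * τ)‖ ^ 2 =
      Real.pi * τ / Real.sinh (Real.pi * τ) := by
    have : ((‖Complex.Gamma (1 + Complex.I * τ)‖ ^ 2 : ℝ) : ℂ) =
        ((Real.pi * τ / Real.sinh (Real.pi * τ) : ℝ) : ℂ) := by
      push_cast
      rw [← Complex.mul_conj', e2, e1, mul_assoc, e3, e4]
      have : ((Real.sinh (Real.pi * τ) : ℝ) : ℂ) ≠ 0 := by exact_mod_cast hsinh
      push_cast at this ⊢
      field_simp
    exact_mod_cast this
  rw [inv_pow, e5, inv_div]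
  -- both sides are even in `πτ`
  have key : ∀ x : ℝ, 0 < x → Real.sinh x / x ≤ Real.cosh x := by
    intro x hx
    rw [div_le_iff₀ hx]
    have hd : ∀ y, HasDerivAt (fun y => Real.cosh y * y - Real.sinh y) (Real.sinh y * y) y := by
      intro y
      have := ((Real.hasDerivAt_cosh y).mul (hasDerivAt_id y)).sub (Real.hasDerivAt_sinh y)
      exact this.congr_deriv (by simp)
    have hmono : MonotoneOn (fun y => Real.cosh y * y - Real.sinh y) (Ici 0) := by
      refine monotoneOn_of_deriv_nonneg (convex_Ici 0)
        (fun y _ => (hd y).continuousAt.continuousWithinAt)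
        (fun y _ => (hd y).differentiableAt.differentiableWithinAt) fun y hy => ?_
      rw [interior_Ici] at hy
      rw [(hd y).deriv]
      exact mul_nonneg (Real.sinh_nonneg_iff.2 (le_of_lt hy)) (le_of_lt hy)
    have := hmono (mem_Ici.2 le_rfl) (mem_Ici.2 hx.le) hx.le
    simp at this
    linarith
  rcases lt_or_gt_of_ne hpt with h | h
  · have := key _ (neg_pos.2 h)
    rwa [Real.sinh_neg, Real.cosh_neg, neg_div_neg_eq] at this
  · exact key _ h

lemma continuousOn_besselI (τ : ℝ) :
    ContinuousOn (fun z : ℝ => besselI (Complex.I * τ) z) (Ioi 0) := by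
  intro z₀ hz₀
  have h : ContinuousOn (fun z : ℝ => besselI (Complex.I * τ) z) (Ioo 0 (z₀ + 1)) := by
    simp_rw [besselI_eq_tsum]
    refine continuousOn_tsum (fun k => ?_)
      ((z₀ + 1).hasSum_cosh.summable.mul_left ‖Complex.Gamma (1 + Complex.I * τ)‖⁻¹)
      fun k z hz => (norm_besselTerm_le τ hz.1 k).trans ?_
    · unfold besselTerm
      refine ContinuousOn.div_const (ContinuousOn.cpow_const (by fun_prop) fun z hz => ?_) _
      left
      simpa using hz.1
    · have := hz.1
      have := hz.2.le
      gcongr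
  exact (h.continuousAt (Ioo_mem_nhds hz₀ (by linarith))).continuousWithinAt

lemma integrableOn_exp_mul_besselI (τ : ℝ) {q : ℝ} (hq : 1 < q) :
    IntegrableOn (fun z : ℝ => (Real.exp (-(q * z)) : ℂ) * besselI (Complex.I * τ) z)
      (Ioi 0) := by
  refine Integrable.mono' (g := fun z => ‖Complex.Gamma (1 + Complex.I * τ)‖⁻¹ *
    Real.exp (-(q - 1) * z)) ((integrableOn_exp_mul_Ioi (by linarith) 0).const_mul _)
    (AEStronglyMeasurable.mul (by fun_prop) 
      ((continuousOn_besselI τ).aestronglyMeasurable measurableSet_Ioi)) ?_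
  filter_upwards [ae_restrict_mem measurableSet_Ioi] with z hz
  have hz : 0 < z := hz
  rw [norm_mul, Complex.norm_real, Real.norm_eq_abs, Real.abs_exp]
  have h1 : Real.cosh z ≤ Real.exp z := by
    rw [Real.cosh_eq]
    have : Real.exp (-z) ≤ Real.exp z := Real.exp_le_exp.2 (by linarith)
    linarith
  calc _ ≤ Real.exp (-(q * z)) * (‖Complex.Gamma (1 + Complex.I * τ)‖⁻¹ * Real.exp z) := by
        gcongr
        exact (norm_besselI_le τ hz).trans (by gcongr)
    _ = _ := by
        rw [mul_left_comm, ← Real.exp_add]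
        ring_nf

lemma exp_mul_besselTerm (τ : ℝ) {q z : ℝ} (hz : 0 < z) (k : ℕ) :
    (Real.exp (-(q * z)) : ℂ) * besselTerm τ z k =
      (1 / 2 : ℂ) ^ (2 * (k : ℂ) + Complex.I * τ) /
        ((k.factorial : ℂ) * Complex.Gamma ((k : ℂ) + Complex.I * τ + 1)) *
      ((z : ℂ) ^ (2 * (k : ℂ) + Complex.I * τ + 1 - 1) * Complex.exp (-(q * z))) := by
  have : ((z : ℂ) / 2) ^ (2 * (k : ℂ) + Complex.I * τ) = (1 / 2 : ℂ) ^ (2 * (k : ℂ) + Complex.I * τ)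
      * (z : ℂ) ^ (2 * (k : ℂ) + Complex.I * τ) := by
    have h := Complex.mul_cpow_ofReal_nonneg (a := 1 / 2) (b := z) (by norm_num) hz.le
      (2 * (k : ℂ) + Complex.I * τ)
    push_cast at h
    rw [← h]
    ring_nf
  rw [besselTerm, this, add_sub_cancel_right]
  push_cast
  ring

lemma integral_exp_mul_besselTerm (τ : ℝ) {q : ℝ} (hq : 0 < q) (k : ℕ) :
    ∫ z in Ioi (0 : ℝ), (Real.exp (-(q * z)) : ℂ) * besselTerm τ z k =
      (1 / 2 : ℂ) ^ (2 * (k : ℂ) + Complex.I * τ) *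
        (1 / q : ℂ) ^ (2 * (k : ℂ) + Complex.I * τ + 1) *
        ((ascPochhammer ℂ k).eval (1 + Complex.I * τ + k) / k.factorial) := by
  rw [setIntegral_congr_fun measurableSet_Ioi fun z hz => exp_mul_besselTerm τ hz k,
    integral_const_mul, Complex.integral_cpow_mul_exp_neg_mul_Ioi (by simp; positivity) hq]
  have h := Gamma_add_natCast (a := k + Complex.I * τ + 1) (by simp; positivity) k
  have hne : Complex.Gamma (k + Complex.I * τ + 1) ≠ 0 :=
    Complex.Gamma_ne_zero_of_re_pos (by simp; positivity)
  rw [show 2 * (k : ℂ) + Complex.I * τ + 1 = k + Complex.I * τ + 1 + k by ring, h,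
    show 1 + Complex.I * (τ : ℂ) + k = k + Complex.I * τ + 1 by ring]
  field_simp

lemma hasSum_integral_exp_mul_besselTerm (τ : ℝ) {q : ℝ} (hq : 1 < q) :
    HasSum (fun k => ∫ z in Ioi (0 : ℝ), (Real.exp (-(q * z)) : ℂ) * besselTerm τ z k)
      (∫ z in Ioi (0 : ℝ), (Real.exp (-(q * z)) : ℂ) * besselI (Complex.I * τ) z) := by
  simp_rw [besselI_eq_tsum, ← tsum_mul_left]
  set c := ‖Complex.Gamma (1 + Complex.I * τ)‖⁻¹
  have hq0 : 0 < q := by linarith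
  have hint : ∀ k : ℕ, IntegrableOn
      (fun z : ℝ => Real.exp (-(q * z)) * (c * (z ^ (2 * k) / ((2 * k).factorial : ℝ)))) (Ioi 0) ∧
      ∫ z in Ioi (0 : ℝ), Real.exp (-(q * z)) * (c * (z ^ (2 * k) / ((2 * k).factorial : ℝ))) =
        c * (1 / q) * ((1 / q) ^ 2) ^ k := by
    intro k
    have hf : (0 : ℝ) < (2 * k).factorial := by positivity
    have e : ∀ z ∈ Ioi (0 : ℝ),
        Real.exp (-(q * z)) * (c * (z ^ (2 * k) / ((2 * k).factorial : ℝ))) =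
        c / (2 * k).factorial * (z ^ (((2 * k : ℕ) : ℝ) + 1 - 1) * Real.exp (-(q * z))) := by
      intro z hz
      rw [add_sub_cancel_right, Real.rpow_natCast]
      ring
    have h1 := Real.integral_rpow_mul_exp_neg_mul_Ioi (a := ((2 * k : ℕ) : ℝ) + 1)
      (by positivity) hq0
    have h2 := integrableOn_rpow_mul_exp (a := ((2 * k : ℕ) : ℝ) + 1) (by positivity) hq0
    refine ⟨(integrableOn_congr_fun e measurableSet_Ioi).2 (h2.const_mul _), ?_⟩
    rw [setIntegral_congr_fun measurableSet_Ioi e, integral_const_mul, h1,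
      Real.Gamma_nat_eq_factorial, ← Nat.cast_succ, Real.rpow_natCast, ← pow_mul, pow_succ]
    field_simp
  have hle : ∀ k : ℕ, ∀ z ∈ Ioi (0 : ℝ), ‖(Real.exp (-(q * z)) : ℂ) * besselTerm τ z k‖ ≤
      Real.exp (-(q * z)) * (c * (z ^ (2 * k) / ((2 * k).factorial : ℝ))) := by
    intro k z hz
    rw [norm_mul, Complex.norm_real, Real.norm_eq_abs, Real.abs_exp]
    exact mul_le_mul_of_nonneg_left (norm_besselTerm_le τ hz k) (Real.exp_pos _).le
  have hterm : ∀ k : ℕ, IntegrableOn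
      (fun z : ℝ => (Real.exp (-(q * z)) : ℂ) * besselTerm τ z k) (Ioi 0) := by
    intro k
    refine (hint k).1.mono' ?_ ?_
    · unfold besselTerm
      exact (by fun_prop : Measurable _).aestronglyMeasurable
    · filter_upwards [ae_restrict_mem measurableSet_Ioi] with z hz using hle k z hz
  refine hasSum_integral_of_summable_integral_norm hterm ?_
  have hr : (1 / q) ^ 2 < 1 := by
    have : 1 / q < 1 := by rw [div_lt_one hq0]; exact hq
    have h0 : 0 < 1 / q := by positivity
    nlinarith
  refine Summable.of_nonneg_of_le (fun k => integral_nonneg fun _ => norm_nonneg _) (fun k => ?_)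
    ((summable_geometric_of_lt_one (by positivity) hr).mul_left (c * (1 / q)))
  rw [← (hint k).2]
  exact setIntegral_mono_on (hterm k).norm (hint k).1 measurableSet_Ioi (hle k)

/-- The Laplace transform of `I_{iτ}` at `cosh u` is `exp (-iτu) / sinh u`: with `r = exp (-2u)`,
`1 / (2 cosh u) = exp (-u) / (1 + r)` turns the termwise integral into the series of
`hasSum_ascPochhammer_mul_cpow`, of which `u ≥ 2` ensures the convergence. -/
lemma integral_exp_mul_besselI (τ : ℝ) {u : ℝ} (hu : 2 ≤ u) :
    ∫ z in Ioi (0 : ℝ), (Real.exp (-(Real.cosh u * z)) : ℂ) * besselI (Complex.I * τ) z =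
      Complex.exp (-(Complex.I * τ * u)) / Real.sinh u := by
  have hq : 1 < Real.cosh u := Real.one_lt_cosh.2 (by linarith)
  have hq0 : 0 < Real.cosh u := by linarith
  set r : ℝ := Real.exp (-(2 * u)) with hr
  have hr0 : 0 < r := Real.exp_pos _
  have hr1 : r < 1 / 8 := by
    have h1 : Real.exp (-(2 * u)) ≤ Real.exp (-1) ^ 4 := by
      rw [← Real.exp_nat_mul]
      exact Real.exp_le_exp.2 (by push_cast; linarith)
    have h2 := Real.exp_neg_one_lt_half
    have h3 : Real.exp (-1) ^ 4 < (1 / 2) ^ 4 :=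
      pow_lt_pow_left₀ h2 (Real.exp_pos _).le (by norm_num)
    norm_num at h3
    linarith
  have hcosh : 1 / 2 * (1 / Real.cosh u) = Real.exp (-u) * (1 / (1 + r)) := by
    rw [Real.cosh_eq, hr, show -(2 * u) = -u + -u by ring, Real.exp_add, Real.exp_neg]
    have := Real.exp_pos u
    field_simp
  have hsinh : Real.sinh u = Real.exp u * (1 - r) / 2 := by
    rw [Real.sinh_eq, hr, show -(2 * u) = -u + -u by ring, Real.exp_add, Real.exp_neg]
    have := Real.exp_pos u
    field_simp
  have h := (hasSum_ascPochhammer_mul_cpow (a := 1 + Complex.I * τ) hr0.le hr1).mul_left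
    (2 * Complex.exp (-u * (1 + Complex.I * τ)))
  have hterm : ∀ k : ℕ, (1 / 2 : ℂ) ^ (2 * (k : ℂ) + Complex.I * τ) *
      (1 / (Real.cosh u : ℝ) : ℂ) ^ (2 * (k : ℂ) + Complex.I * τ + 1) =
      2 * Complex.exp (-u * (1 + Complex.I * τ)) * ((r : ℂ) ^ k *
        (1 + (r : ℂ)) ^ (-(1 + Complex.I * τ + 2 * k))) := by
    intro k
    set w : ℂ := 2 * (k : ℂ) + Complex.I * τ + 1 with hw
    have e1 : (1 / 2 : ℂ) ^ (2 * (k : ℂ) + Complex.I * τ) = 2 * (1 / 2 : ℂ) ^ w := by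
      rw [hw, Complex.cpow_add _ 1 (by norm_num), Complex.cpow_one]
      ring
    have e2 : (1 / 2 : ℂ) ^ w * (1 / (Real.cosh u : ℝ) : ℂ) ^ w =
        ((Real.exp (-u) : ℝ) : ℂ) ^ w * ((1 / (1 + r) : ℝ) : ℂ) ^ w := by
      have h1 := Complex.mul_cpow_ofReal_nonneg (a := 1 / 2) (b := 1 / Real.cosh u) (by norm_num)
        (by positivity) w
      rw [← Complex.mul_cpow_ofReal_nonneg (Real.exp_pos _).le (by positivity),
        ← Complex.ofReal_mul,
        ← hcosh, Complex.ofReal_mul, h1]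
      push_cast
      rfl
    have e3 : ((Real.exp (-u) : ℝ) : ℂ) ^ w =
        Complex.exp (-u * (1 + Complex.I * τ)) * (r : ℂ) ^ k := by
      rw [Complex.cpow_def_of_ne_zero (by exact_mod_cast (Real.exp_pos _).ne'),
        ← Complex.ofReal_log (Real.exp_pos _).le, Real.log_exp, hr, Complex.ofReal_exp,
        ← Complex.exp_nat_mul, ← Complex.exp_add, hw]
      push_cast
      ring_nf
    have e4 : ((1 / (1 + r) : ℝ) : ℂ) ^ w = (1 + (r : ℂ)) ^ (-(1 + Complex.I * τ + 2 * k)) := by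
      have hpos : 0 < 1 + r := by positivity
      have harg : Complex.arg (1 + (r : ℂ)) ≠ Real.pi := by
        rw [show (1 + (r : ℂ)) = ((1 + r : ℝ) : ℂ) by push_cast; rfl,
          Complex.arg_ofReal_of_nonneg hpos.le]
        exact Real.pi_ne_zero.symm
      rw [Complex.cpow_neg, ← Complex.inv_cpow _ _ harg, hw]
      push_cast
      rw [one_div]
      ring_nf
    rw [e1, mul_assoc, e2, e3, e4]
    ring
  have h2 := hasSum_integral_exp_mul_besselTerm τ hq
  have h3 := h2.unique (Eq.subst (motive := fun f => HasSum f _) (funext fun k => ?_) h)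
  · rw [h3, hsinh]
    have e5 : Complex.exp (-u * (1 + Complex.I * τ)) =
        Complex.exp (-(Complex.I * τ * u)) * (Complex.exp u)⁻¹ := by
      rw [← Complex.exp_neg, ← Complex.exp_add]
      ring_nf
    have h1r : (1 - (r : ℂ)) ≠ 0 := by
      have : (1 - r : ℝ) ≠ 0 := by linarith
      exact_mod_cast this
    rw [e5]
    push_cast
    have := Complex.exp_ne_zero u
    field_simp
  · rw [integral_exp_mul_besselTerm τ hq0, hterm k]
    ring

lemma integral_exp_mul_besselI_re (τ : ℝ) {u : ℝ} (hu : 2 ≤ u) :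
    ∫ z in Ioi (0 : ℝ), Real.exp (-(Real.cosh u * z)) * (besselI (Complex.I * τ) z).re =
      Real.cos (τ * u) / Real.sinh u := by
  have hq : 1 < Real.cosh u := Real.one_lt_cosh.2 (by linarith)
  have h := integral_re (𝕜 := ℂ) (integrableOn_exp_mul_besselI τ hq)
  rw [integral_exp_mul_besselI τ hu] at h
  simp only [RCLike.re_to_complex, Complex.re_ofReal_mul, Complex.div_ofReal_re] at h
  rw [h, show -(Complex.I * (τ : ℂ) * u) = ((-(τ * u) : ℝ) : ℂ) * Complex.I by push_cast; ring,
    Complex.exp_ofReal_mul_I_re, Real.cos_neg]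

lemma integrableOn_exp_mul_besselI_re (τ : ℝ) {q : ℝ} (hq : 1 < q) :
    IntegrableOn (fun z : ℝ => Real.exp (-(q * z)) * (besselI (Complex.I * τ) z).re) (Ioi 0) := by
  have h := (integrableOn_exp_mul_besselI τ hq).re
  simp only [RCLike.re_to_complex, Complex.re_ofReal_mul] at h
  exact h

/-! ### The Fourier transform of `1 / cosh` -/

/-- The integrand of `B(1/2 + iτ, 1/2 - iτ)` at `x = 1 / (1 + exp (-y))`, times `dx/dy`. With
`t = 1 - x` one has `x = t exp y` and `t = exp (-y / 2) / (2 cosh (y / 2))`. -/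
lemma sigmoid_mul_beta_integrand (τ y : ℝ) :
    |Real.sigmoid y * (1 - Real.sigmoid y)| •
      (((Real.sigmoid y : ℝ) : ℂ) ^ ((1 / 2 + Complex.I * τ : ℂ) - 1) *
        (1 - ((Real.sigmoid y : ℝ) : ℂ)) ^ ((1 / 2 - Complex.I * τ : ℂ) - 1)) =
      Complex.exp (Complex.I * τ * y) / (2 * Real.cosh (y / 2) : ℝ) := by
  set t := 1 - Real.sigmoid y with ht
  have ht0 : 0 < t := by have := Real.sigmoid_lt_one y; linarith
  have htc : (t : ℂ) ≠ 0 := by exact_mod_cast ht0.ne'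
  have hs : Real.sigmoid y = Real.exp y * t := by
    have h := Real.sigmoid_mul_rexp_neg y
    rw [Real.sigmoid_neg, ← ht] at h
    rw [← h, mul_left_comm, ← Real.exp_add, add_neg_cancel, Real.exp_zero, mul_one]
  have htv : t * (2 * Real.cosh (y / 2)) = Real.exp (-(y / 2)) := by
    have h1 : t * (1 + Real.exp y) = 1 := by linear_combination ht - hs
    have h2 : Real.exp y = Real.exp (y / 2) * Real.exp (y / 2) := by
      rw [← Real.exp_add]; ring_nf
    rw [Real.cosh_eq, Real.exp_neg]
    rw [h2] at h1
    have := Real.exp_pos (y / 2)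
    field_simp
    linarith
  have hcosh : 0 < 2 * Real.cosh (y / 2) := by have := Real.cosh_pos (y / 2); positivity
  rw [show (1 : ℂ) - ((Real.sigmoid y : ℝ) : ℂ) = (t : ℂ) by rw [ht]; push_cast; rfl,
    abs_of_pos (mul_pos (Real.sigmoid_pos y) ht0), hs, Complex.ofReal_mul,
    Complex.mul_cpow_ofReal_nonneg (Real.exp_pos y).le ht0.le, Complex.real_smul]
  have e1 : (t : ℂ) ^ ((1 / 2 + Complex.I * τ : ℂ) - 1) *
      (t : ℂ) ^ ((1 / 2 - Complex.I * τ : ℂ) - 1) = (t : ℂ)⁻¹ := by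
    rw [← Complex.cpow_add _ _ htc, ← Complex.cpow_neg_one]
    ring_nf
  have e2 : ((Real.exp y : ℝ) : ℂ) ^ ((1 / 2 + Complex.I * τ : ℂ) - 1) =
      Complex.exp (Complex.I * τ * y) * Complex.exp (-(y / 2)) := by
    rw [Complex.cpow_def_of_ne_zero (by exact_mod_cast (Real.exp_pos y).ne'),
      ← Complex.ofReal_log (Real.exp_pos y).le, Real.log_exp, ← Complex.exp_add]
    ring_nf
  have htv' : (t : ℂ) = Complex.exp (-(y / 2)) / (2 * Real.cosh (y / 2) : ℝ) := by
    rw [eq_div_iff (by exact_mod_cast hcosh.ne')]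
    exact_mod_cast htv
  have e3 : Complex.exp (-(y / 2)) * Complex.exp (-(y / 2)) * Complex.exp y = 1 := by
    rw [← Complex.exp_add, ← Complex.exp_add]
    ring_nf
    simp
  calc _ = ((Real.exp y : ℝ) : ℂ) * t * t * (((Real.exp y : ℝ) : ℂ) ^
        ((1 / 2 + Complex.I * τ : ℂ) - 1)) * ((t : ℂ) ^ ((1 / 2 + Complex.I * τ : ℂ) - 1) *
      (t : ℂ) ^ ((1 / 2 - Complex.I * τ : ℂ) - 1)) := by push_cast; ring
    _ = Complex.exp y * t * (Complex.exp (Complex.I * τ * y) * Complex.exp (-(y / 2))) := by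
        rw [e1, e2, Complex.ofReal_exp]
        field_simp
    _ = _ := by
        rw [htv']
        linear_combination (Complex.exp (Complex.I * τ * y) / (2 * Real.cosh (y / 2) : ℝ)) * e3

/-- The substitution `x = 1 / (1 + exp (-y))` in the Beta integral `B(1/2 + iτ, 1/2 - iτ)`,
together with the reflection formula. -/
lemma integrable_and_integral_exp_div_cosh (τ : ℝ) :
    Integrable (fun y : ℝ => Complex.exp (Complex.I * τ * y) / (2 * Real.cosh (y / 2) : ℝ)) ∧
    ∫ y : ℝ, Complex.exp (Complex.I * τ * y) / (2 * Real.cosh (y / 2) : ℝ) =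
      (Real.pi / Real.cosh (Real.pi * τ) : ℝ) := by
  have hu : 0 < (1 / 2 + Complex.I * τ : ℂ).re := by simp
  have hv : 0 < (1 / 2 - Complex.I * τ : ℂ).re := by simp
  have hd : ∀ y ∈ (univ : Set ℝ), HasDerivWithinAt Real.sigmoid
      (Real.sigmoid y * (1 - Real.sigmoid y)) univ y := fun y _ =>
    (Real.hasDerivAt_sigmoid y).hasDerivWithinAt
  have hconv := Complex.betaIntegral_convergent hu hv
  rw [intervalIntegrable_iff_integrableOn_Ioo_of_le zero_le_one, ← Real.range_sigmoid,
    ← image_univ, integrableOn_image_iff_integrableOn_abs_deriv_smul MeasurableSet.univ hd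
      Real.sigmoid_injective.injOn, integrableOn_univ] at hconv
  simp_rw [sigmoid_mul_beta_integrand] at hconv
  refine ⟨hconv, ?_⟩
  have hval := Complex.betaIntegral_eq_Gamma_mul_div _ _ hu hv
  rw [Complex.betaIntegral, intervalIntegral.integral_of_le zero_le_one,
    integral_Ioc_eq_integral_Ioo, ← Real.range_sigmoid, ← image_univ,
    integral_image_eq_integral_abs_deriv_smul MeasurableSet.univ hd
      Real.sigmoid_injective.injOn, setIntegral_univ] at hval
  simp_rw [sigmoid_mul_beta_integrand] at hval
  rw [hval, show (1 / 2 - Complex.I * τ : ℂ) = 1 - (1 / 2 + Complex.I * τ) by ring,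
    Complex.Gamma_mul_Gamma_one_sub, add_sub_cancel, Complex.Gamma_one, div_one,
    show (Real.pi : ℂ) * (1 / 2 + Complex.I * τ) =
      ((Real.pi * τ : ℝ) : ℂ) * Complex.I + Real.pi / 2 by push_cast; ring,
    Complex.sin_add_pi_div_two, Complex.cos_mul_I]
  push_cast
  rfl

lemma integrable_inv_cosh_half : Integrable fun y : ℝ => (Real.cosh (y / 2))⁻¹ := by
  have h := ((integrable_and_integral_exp_div_cosh 0).1.norm.const_mul 2)
  refine h.congr (ae_of_all _ fun y => ?_)
  have := Real.cosh_pos (y / 2)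
  simp only [Complex.ofReal_zero, mul_zero, zero_mul, Complex.exp_zero, norm_div, norm_one,
    Complex.norm_real, Real.norm_eq_abs, abs_of_pos (by positivity : 0 < 2 * Real.cosh (y / 2))]
  field_simp

lemma integral_cos_div_cosh_half_sub (τ u : ℝ) :
    ∫ y : ℝ, Real.cos (τ * y) / Real.cosh ((y - u) / 2) =
      2 * Real.pi * Real.cos (τ * u) / Real.cosh (Real.pi * τ) := by
  rw [← integral_add_right_eq_self _ u]
  obtain ⟨h1, h2⟩ := integrable_and_integral_exp_div_cosh τ
  have h3 := integral_re (𝕜 := ℂ) (h1.const_mul (2 * Complex.exp (Complex.I * τ * u)))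
  rw [integral_const_mul, h2] at h3
  have e : ∀ y : ℝ, RCLike.re (2 * Complex.exp (Complex.I * τ * u) *
      (Complex.exp (Complex.I * τ * y) / (2 * Real.cosh (y / 2) : ℝ))) =
      Real.cos (τ * (y + u)) / Real.cosh ((y + u - u) / 2) := by
    intro y
    rw [add_sub_cancel_right, ← mul_div_assoc, mul_assoc, ← Complex.exp_add,
      show Complex.I * (τ : ℂ) * u + Complex.I * τ * y = ((τ * (y + u) : ℝ) : ℂ) * Complex.I by
        push_cast; ring, RCLike.re_to_complex, Complex.div_ofReal_re,
      show (2 : ℂ) = ((2 : ℝ) : ℂ) by norm_num, Complex.re_ofReal_mul, Complex.exp_ofReal_mul_I_re]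
    have := Real.cosh_pos (y / 2)
    field_simp
  simp_rw [e] at h3
  rw [h3, show Complex.I * (τ : ℂ) * u = ((τ * u : ℝ) : ℂ) * Complex.I by push_cast; ring,
    RCLike.re_to_complex, Complex.re_mul_ofReal, show (2 : ℂ) = ((2 : ℝ) : ℂ) by norm_num,
    Complex.re_ofReal_mul, Complex.exp_ofReal_mul_I_re]
  ring

/-- Folding an integral over the line into one over the half-line. -/
lemma integral_eq_integral_Ioi_add {E : Type*} [NormedAddCommGroup E] [NormedSpace ℝ E]
    {f : ℝ → E} (hf : Integrable f) :
    ∫ y, f y = ∫ y in Ioi (0 : ℝ), (f y + f (-y)) := by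
  rw [integral_add hf.integrableOn hf.comp_neg.integrableOn, integral_comp_neg_Ioi, neg_zero,
    add_comm, intervalIntegral.integral_Iic_add_Ioi hf.integrableOn hf.integrableOn]

/-- Folding the line onto the half-line adds the two translates `1 / cosh ((y ± u) / 2)`; their sum
is `2 cosh (y / 2) cosh (u / 2)` over the product
`cosh ((y + u) / 2) cosh ((y - u) / 2) = sinh² (u / 2) + cosh² (y / 2)`. -/
lemma integral_cos_mul_cosh_div (τ u : ℝ) :
    ∫ y in Ioi (0 : ℝ), Real.cos (τ * y) * Real.cosh (y / 2) /
        (Real.sinh (u / 2) ^ 2 + Real.cosh (y / 2) ^ 2) =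
      Real.pi * Real.cos (τ * u) / (Real.cosh (u / 2) * Real.cosh (Real.pi * τ)) := by
  have hint : Integrable fun y : ℝ => Real.cos (τ * y) / Real.cosh ((y - u) / 2) := by
    have h1 := integrable_inv_cosh_half.comp_sub_right u
    exact h1.bdd_mul (c := 1) (by fun_prop) (ae_of_all _ fun y => Real.abs_cos_le_one _)
  have h := integral_eq_integral_Ioi_add hint
  rw [integral_cos_div_cosh_half_sub] at h
  have e : ∀ y : ℝ, Real.cos (τ * y) / Real.cosh ((y - u) / 2) +
      Real.cos (τ * -y) / Real.cosh ((-y - u) / 2) = 2 * Real.cosh (u / 2) *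
      (Real.cos (τ * y) * Real.cosh (y / 2) /
        (Real.sinh (u / 2) ^ 2 + Real.cosh (y / 2) ^ 2)) := by
    intro y
    have h1 := Real.cosh_pos ((y - u) / 2)
    have h2 := Real.cosh_pos ((y + u) / 2)
    have h3 : Real.cosh ((y - u) / 2) * Real.cosh ((y + u) / 2) =
        Real.sinh (u / 2) ^ 2 + Real.cosh (y / 2) ^ 2 := by
      rw [sub_div, add_div, Real.cosh_sub, Real.cosh_add]
      have e1 := Real.cosh_sq (u / 2)
      have e2 := Real.cosh_sq (y / 2)
      linear_combination Real.cosh (y / 2) ^ 2 * e1 + Real.sinh (u / 2) ^ 2 * e2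
    have h4 : Real.cosh ((y - u) / 2) + Real.cosh ((y + u) / 2) =
        2 * Real.cosh (y / 2) * Real.cosh (u / 2) := by
      rw [sub_div, add_div, Real.cosh_sub, Real.cosh_add]
      ring
    rw [show (-y - u) / 2 = -((y + u) / 2) by ring, Real.cosh_neg, mul_neg, Real.cos_neg, ← h3]
    field_simp
    linear_combination Real.cos (τ * y) * h4
  simp_rw [e] at h
  rw [integral_const_mul] at h
  have h1 := Real.cosh_pos (u / 2)
  have h2 := Real.cosh_pos (Real.pi * τ)
  have h3 : (2 * Real.cosh (u / 2)) * ∫ y in Ioi (0 : ℝ), Real.cos (τ * y) * Real.cosh (y / 2) /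
        (Real.sinh (u / 2) ^ 2 + Real.cosh (y / 2) ^ 2) = (2 * Real.cosh (u / 2)) *
      (Real.pi * Real.cos (τ * u) / (Real.cosh (u / 2) * Real.cosh (Real.pi * τ))) := by
    rw [← h]
    field_simp
  exact mul_left_cancel₀ (by positivity) h3

/-! ### The cosine transform of `cosh (y / 2) ₁F₁(1; 3/2; -x cosh² (y / 2))` -/

lemma cosh_mul_kummerF_nonneg (x y : ℝ) :
    0 ≤ Real.cosh (y / 2) * kummerF (1 : ℝ) (3 / 2) (-x * Real.cosh (y / 2) ^ 2) := by
  rw [neg_mul]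
  exact mul_nonneg (Real.cosh_pos _).le (kummerF_nonneg _)

lemma cosh_mul_kummerF_le {x : ℝ} (hx : 0 < x) (y : ℝ) :
    Real.cosh (y / 2) * kummerF (1 : ℝ) (3 / 2) (-x * Real.cosh (y / 2) ^ 2) ≤
      x⁻¹ * (Real.cosh (y / 2))⁻¹ := by
  have hc := Real.cosh_pos (y / 2)
  rw [neg_mul]
  calc _ ≤ Real.cosh (y / 2) * (1 / (x * Real.cosh (y / 2) ^ 2)) :=
        mul_le_mul_of_nonneg_left (kummerF_le_inv (by positivity)) hc.le
    _ = _ := by field_simp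

lemma continuous_cosh_mul_kummerF :
    Continuous fun z : ℝ × ℝ =>
      Real.cosh (z.2 / 2) * kummerF (1 : ℝ) (3 / 2) (-z.1 * Real.cosh (z.2 / 2) ^ 2) := by
  simp_rw [neg_mul]
  have h : Continuous fun z : ℝ × ℝ => z.1 * Real.cosh (z.2 / 2) ^ 2 := by fun_prop
  exact Continuous.mul (by fun_prop) (continuous_kummerF.comp h)

lemma norm_cos_mul_cosh_mul_kummerF_le (τ : ℝ) {x : ℝ} (hx : 0 < x) (y : ℝ) :
    ‖Real.cos (τ * y) * Real.cosh (y / 2) *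
      kummerF (1 : ℝ) (3 / 2) (-x * Real.cosh (y / 2) ^ 2)‖ ≤ x⁻¹ * (Real.cosh (y / 2))⁻¹ := by
  rw [mul_assoc, norm_mul, Real.norm_eq_abs, Real.norm_eq_abs,
    abs_of_nonneg (cosh_mul_kummerF_nonneg x y)]
  exact (mul_le_of_le_one_left (cosh_mul_kummerF_nonneg x y) (Real.abs_cos_le_one _)).trans
    (cosh_mul_kummerF_le hx y)

lemma continuous_cos_mul_cosh_mul_kummerF :
    Continuous fun z : ℝ × ℝ × ℝ => Real.cos (z.1 * z.2.2) * Real.cosh (z.2.2 / 2) *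
      kummerF (1 : ℝ) (3 / 2) (-z.2.1 * Real.cosh (z.2.2 / 2) ^ 2) := by
  simp_rw [mul_assoc]
  exact Continuous.mul (by fun_prop) (continuous_cosh_mul_kummerF.comp continuous_snd)

lemma integrable_cos_mul_cosh_mul_kummerF (τ : ℝ) {x : ℝ} (hx : 0 < x) :
    Integrable fun y : ℝ => Real.cos (τ * y) * Real.cosh (y / 2) *
      kummerF (1 : ℝ) (3 / 2) (-x * Real.cosh (y / 2) ^ 2) :=
  (integrable_inv_cosh_half.const_mul x⁻¹).mono'
    (continuous_cos_mul_cosh_mul_kummerF.comp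
      (f := fun y : ℝ => (τ, x, y)) (by fun_prop)).aestronglyMeasurable
    (ae_of_all _ (norm_cos_mul_cosh_mul_kummerF_le τ hx))

/-- The cosine transform of `y ↦ √x cosh (y / 2) ₁F₁(1; 3/2; -x cosh² (y / 2))`, as a function of
`x`. -/
noncomputable def cosineTransform (τ x : ℝ) : ℝ :=
  √x * ∫ y in Ioi (0 : ℝ), Real.cos (τ * y) * Real.cosh (y / 2) *
    kummerF (1 : ℝ) (3 / 2) (-x * Real.cosh (y / 2) ^ 2)

lemma continuousOn_cosineTransform (τ : ℝ) : ContinuousOn (cosineTransform τ) (Ioi 0) := by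
  intro x₀ hx₀
  have hx₀ : 0 < x₀ := hx₀
  refine (ContinuousAt.mul (by fun_prop) ?_).continuousWithinAt
  refine continuousAt_of_dominated (bound := fun y => (x₀ / 2)⁻¹ * (Real.cosh (y / 2))⁻¹) ?_ ?_
    (integrable_inv_cosh_half.const_mul _).integrableOn ?_
  · exact Eventually.of_forall fun x => (continuous_cos_mul_cosh_mul_kummerF.comp
      (f := fun y : ℝ => (τ, x, y)) (by fun_prop)).aestronglyMeasurable
  · filter_upwards [lt_mem_nhds (half_lt_self hx₀)] with x hx
    refine ae_of_all _ fun y => ?_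
    have hx' : 0 < x := by linarith
    refine (norm_cos_mul_cosh_mul_kummerF_le τ hx' y).trans ?_
    have := Real.cosh_pos (y / 2)
    gcongr
  · exact ae_of_all _ fun y => (continuous_cos_mul_cosh_mul_kummerF.comp
      (f := fun x : ℝ => (τ, x, y)) (by fun_prop)).continuousAt

/-- The Laplace transform in `x` of the cosine transform, by Fubini. -/
lemma laplace_cosineTransform (τ : ℝ) {u : ℝ} (hu : 0 < u) :
    IntegrableOn (fun x => Real.exp (-(Real.sinh (u / 2) ^ 2 * x)) * cosineTransform τ x) (Ioi 0) ∧
    ∫ x in Ioi (0 : ℝ), Real.exp (-(Real.sinh (u / 2) ^ 2 * x)) * cosineTransform τ x =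
      √Real.pi * Real.pi * Real.cos (τ * u) / (Real.sinh u * Real.cosh (Real.pi * τ)) := by
  have hs : 0 < Real.sinh (u / 2) := Real.sinh_pos_iff.2 (by linarith)
  set p := Real.sinh (u / 2) ^ 2 with hp
  have hp0 : 0 < p := by positivity
  set G : ℝ → ℝ → ℝ := fun x y => Real.exp (-(p * x)) * (√x * (Real.cos (τ * y) *
    Real.cosh (y / 2) * kummerF (1 : ℝ) (3 / 2) (-x * Real.cosh (y / 2) ^ 2))) with hG
  have hint : Integrable (Function.uncurry G)
      ((volume.restrict (Ioi 0)).prod (volume.restrict (Ioi 0))) := by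
    have h1 := integrableOn_rpow_mul_exp (a := 1 / 2) (r := p) (by norm_num) hp0
    refine Integrable.mono' (g := fun z : ℝ × ℝ =>
      z.1 ^ ((1 / 2 : ℝ) - 1) * Real.exp (-(p * z.1)) * (Real.cosh (z.2 / 2))⁻¹)
      (Integrable.mul_prod h1 integrable_inv_cosh_half.integrableOn) ?_ ?_
    · have hc : Continuous (Function.uncurry G) := by
        refine Continuous.mul (by fun_prop) (Continuous.mul (by fun_prop) ?_)
        exact continuous_cos_mul_cosh_mul_kummerF.comp
          (f := fun z : ℝ × ℝ => (τ, z.1, z.2)) (by fun_prop)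
      exact hc.aestronglyMeasurable
    · rw [Measure.prod_restrict]
      filter_upwards [ae_restrict_mem (measurableSet_Ioi.prod measurableSet_Ioi)] with z hz
      have hz1 : 0 < z.1 := hz.1
      have h2 : z.1 ^ ((1 / 2 : ℝ) - 1) = √z.1 * z.1⁻¹ := by
        rw [Real.rpow_sub hz1, Real.rpow_one, Real.sqrt_eq_rpow, div_eq_mul_inv]
      simp only [Function.uncurry, hG]
      rw [norm_mul, norm_mul, Real.norm_eq_abs, Real.norm_eq_abs, Real.abs_exp,
        abs_of_nonneg (Real.sqrt_nonneg _), h2]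
      calc _ ≤ Real.exp (-(p * z.1)) * (√z.1 * (z.1⁻¹ * (Real.cosh (z.2 / 2))⁻¹)) := by
            gcongr
            exact norm_cos_mul_cosh_mul_kummerF_le τ hz1 z.2
        _ = _ := by ring
  have hL : ∀ x, ∫ y in Ioi (0 : ℝ), G x y = Real.exp (-(p * x)) * cosineTransform τ x := by
    intro x
    simp only [hG, cosineTransform]
    rw [integral_const_mul, integral_const_mul]
  constructor
  · have h := hint.integral_prod_left
    simp only [Function.uncurry_apply_pair, hL] at h
    exact h
  · simp_rw [← hL]
    rw [integral_integral_swap hint]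
    have hR : ∀ y, ∫ x in Ioi (0 : ℝ), G x y = √Real.pi / 2 / Real.sinh (u / 2) *
        (Real.cos (τ * y) * Real.cosh (y / 2) / (p + Real.cosh (y / 2) ^ 2)) := by
      intro y
      have hc := Real.cosh_pos (y / 2)
      have h := integral_exp_mul_sqrt_mul_kummerF (a := Real.cosh (y / 2) ^ 2) hp0 (by positivity)
      have hsq : √p = Real.sinh (u / 2) := Real.sqrt_sq hs.le
      rw [hsq] at h
      have e : ∀ x, G x y = Real.cos (τ * y) * Real.cosh (y / 2) * (Real.exp (-(p * x)) *
          (√x * kummerF (1 : ℝ) (3 / 2) (-(Real.cosh (y / 2) ^ 2 * x)))) := by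
        intro x
        simp only [hG]
        rw [show -(Real.cosh (y / 2) ^ 2 * x) = -x * Real.cosh (y / 2) ^ 2 by ring]
        ring
      simp_rw [e]
      rw [integral_const_mul, h]
      field_simp
    simp_rw [hR]
    rw [integral_const_mul, hp, integral_cos_mul_cosh_div]
    have h2 : Real.sinh u = 2 * Real.sinh (u / 2) * Real.cosh (u / 2) := by
      rw [← Real.sinh_two_mul]
      ring_nf
    rw [h2]
    have := Real.cosh_pos (u / 2)
    have := Real.cosh_pos (Real.pi * τ)
    field_simp

/-- The Laplace transform in `x` of the kernel `Ψ_τ`, at the point `sinh² (u / 2)`, is the Laplace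
transform of `Re I_{iτ}` at `2 sinh² (u / 2) + 1 = cosh u`. -/
lemma laplace_lebedevSkalskayaKernel (τ : ℝ) {u : ℝ} (hu : 2 ≤ u) :
    IntegrableOn (fun x => Real.exp (-(Real.sinh (u / 2) ^ 2 * x)) *
      lebedevSkalskayaKernel τ x) (Ioi 0) ∧
    ∫ x in Ioi (0 : ℝ), Real.exp (-(Real.sinh (u / 2) ^ 2 * x)) * lebedevSkalskayaKernel τ x =
      2 * √Real.pi * Real.cos (τ * u) / (Real.sinh u * Real.cosh (Real.pi * τ)) := by
  have hq : 1 < Real.cosh u := Real.one_lt_cosh.2 (by linarith)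
  have hcu : Real.cosh u = 2 * Real.sinh (u / 2) ^ 2 + 1 := by
    have h1 := Real.cosh_two_mul (u / 2)
    have h2 := Real.cosh_sq (u / 2)
    rw [mul_div_cancel₀ _ two_ne_zero] at h1
    linarith
  set g : ℝ → ℝ := fun z => √Real.pi / Real.cosh (Real.pi * τ) *
    (Real.exp (-(Real.cosh u * z)) * (besselI (Complex.I * τ) z).re) with hg
  have e : ∀ x : ℝ, Real.exp (-(Real.sinh (u / 2) ^ 2 * x)) * lebedevSkalskayaKernel τ x =
      g (1 / 2 * x) := by
    intro x
    have h1 : Real.exp (-(Real.cosh u * (1 / 2 * x))) =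
        Real.exp (-(Real.sinh (u / 2) ^ 2 * x)) * Real.exp (-x / 2) := by
      rw [← Real.exp_add, hcu]
      ring_nf
    simp only [hg, lebedevSkalskayaKernel]
    rw [h1, show (1 / 2 * x : ℝ) = x / 2 by ring]
    ring
  simp_rw [e]
  constructor
  · rw [integrableOn_Ioi_comp_mul_left_iff _ _ (by norm_num : (0 : ℝ) < 1 / 2), mul_zero]
    exact (integrableOn_exp_mul_besselI_re τ hq).const_mul _
  · rw [integral_comp_mul_left_Ioi g 0 (by norm_num : (0 : ℝ) < 1 / 2), mul_zero,
      integral_const_mul, integral_exp_mul_besselI_re τ hu, smul_eq_mul]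
    have := Real.cosh_pos (Real.pi * τ)
    field_simp

lemma continuousOn_lebedevSkalskayaKernel (τ : ℝ) :
    ContinuousOn (lebedevSkalskayaKernel τ) (Ioi 0) := by
  unfold lebedevSkalskayaKernel
  refine ContinuousOn.mul (by fun_prop) (Complex.continuous_re.comp_continuousOn ?_)
  exact (continuousOn_besselI τ).comp (by fun_prop) fun x hx => half_pos (mem_Ioi.1 hx)

/-- Both sides are continuous in `x > 0`, and their Laplace transforms agree at every
`p ≥ sinh² 1`, since such `p` are the numbers `sinh² (u / 2)` with `u ≥ 2`. -/
lemma cosineTransform_eq (τ : ℝ) {x : ℝ} (hx : 0 < x) :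
    cosineTransform τ x = Real.pi / 2 * lebedevSkalskayaKernel τ x := by
  have hlap : ∀ p ≥ Real.sinh 1 ^ 2,
      IntegrableOn (fun x => Real.exp (-(p * x)) *
        (cosineTransform τ x - Real.pi / 2 * lebedevSkalskayaKernel τ x)) (Ioi 0) ∧
      ∫ x in Ioi (0 : ℝ), Real.exp (-(p * x)) *
        (cosineTransform τ x - Real.pi / 2 * lebedevSkalskayaKernel τ x) = 0 := by
    intro p hp
    obtain ⟨u, hu, rfl⟩ : ∃ u : ℝ, 2 ≤ u ∧ Real.sinh (u / 2) ^ 2 = p := by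
      have h1 : 0 ≤ Real.sinh 1 := Real.sinh_nonneg_iff.2 zero_le_one
      refine ⟨2 * Real.arsinh √p, ?_, ?_⟩
      · have h2 : Real.sinh 1 ≤ √p := Real.le_sqrt_of_sq_le hp
        have h3 := Real.arsinh_le_arsinh.2 h2
        rw [Real.arsinh_sinh] at h3
        linarith
      · rw [mul_div_cancel_left₀ _ two_ne_zero, Real.sinh_arsinh,
          Real.sq_sqrt ((sq_nonneg _).trans hp)]
    obtain ⟨i1, v1⟩ := laplace_cosineTransform τ (u := u) (by linarith)
    obtain ⟨i2, v2⟩ := laplace_lebedevSkalskayaKernel τ hu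
    simp_rw [mul_sub, mul_left_comm _ (Real.pi / 2)]
    refine ⟨i1.sub (i2.const_mul _), ?_⟩
    rw [integral_sub i1 (i2.const_mul _), integral_const_mul, v1, v2]
    ring
  have h := eq_zero_of_laplace_eq_zero
    ((continuousOn_cosineTransform τ).sub ((continuousOn_lebedevSkalskayaKernel τ).const_mul _))
    (Real.sinh 1 ^ 2) (hlap _ le_rfl).1 (fun p hp => (hlap p hp).2) hx
  exact sub_eq_zero.1 h

lemma lebedevSkalskayaKernel_eq_integral (τ : ℝ) {x : ℝ} (hx : 0 < x) :
    lebedevSkalskayaKernel τ x =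
      2 * √x / Real.pi * ∫ y in Ioi (0 : ℝ), Real.cos (τ * y) * Real.cosh (y / 2) *
        kummerF (1 : ℝ) (3 / 2) (-x * Real.cosh (y / 2) ^ 2) := by
  have h := cosineTransform_eq τ hx
  rw [cosineTransform] at h
  rw [div_mul_eq_mul_div, eq_div_iff Real.pi_ne_zero]
  linear_combination -2 * h

/-! ### Fourier inversion -/

lemma lebedevSkalskayaKernel_neg (τ : ℝ) {x : ℝ} (hx : 0 < x) :
    lebedevSkalskayaKernel (-τ) x = lebedevSkalskayaKernel τ x := by
  simp_rw [lebedevSkalskayaKernel_eq_integral _ hx, neg_mul τ, Real.cos_neg]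

lemma continuous_lebedevSkalskayaKernel {x : ℝ} (hx : 0 < x) :
    Continuous fun τ => lebedevSkalskayaKernel τ x := by
  simp_rw [lebedevSkalskayaKernel_eq_integral _ hx]
  refine continuous_const.mul (continuous_of_dominated (fun τ => ?_)
    (fun τ => ae_of_all _ (norm_cos_mul_cosh_mul_kummerF_le τ hx))
    (integrable_inv_cosh_half.const_mul _).integrableOn (ae_of_all _ fun y => ?_))
  · exact (integrable_cos_mul_cosh_mul_kummerF τ hx).aestronglyMeasurable.restrict
  · exact continuous_cos_mul_cosh_mul_kummerF.comp (f := fun τ : ℝ => (τ, x, y)) (by fun_prop)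

/-- The kernel decays at least like `cosh (πτ) ^ (-1/2)`, as `1 / |Γ(1 + iτ)|` grows at most like
`cosh (πτ) ^ (1/2)`. -/
lemma integrable_lebedevSkalskayaKernel {x : ℝ} (hx : 0 < x) :
    Integrable fun τ => lebedevSkalskayaKernel τ x := by
  have h1 : Integrable fun τ : ℝ => (Real.cosh (Real.pi * τ / 2))⁻¹ :=
    integrable_inv_cosh_half.comp_mul_left' Real.pi_ne_zero
  refine (h1.const_mul (√Real.pi * Real.exp (-x / 2) * Real.cosh (x / 2))).mono'
    (continuous_lebedevSkalskayaKernel hx).aestronglyMeasurable (ae_of_all _ fun τ => ?_)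
  have hI : |(besselI (Complex.I * τ) ((x / 2 : ℝ) : ℂ)).re| ≤
      ‖Complex.Gamma (1 + Complex.I * τ)‖⁻¹ * Real.cosh (x / 2) :=
    (Complex.abs_re_le_norm _).trans (norm_besselI_le τ (half_pos hx))
  have hc := Real.cosh_pos (Real.pi * τ)
  have hc2 := Real.cosh_pos (Real.pi * τ / 2)
  have hG : ‖Complex.Gamma (1 + Complex.I * τ)‖⁻¹ / Real.cosh (Real.pi * τ) ≤
      (Real.cosh (Real.pi * τ / 2))⁻¹ := by
    have e1 : Real.cosh (Real.pi * τ / 2) ^ 2 ≤ Real.cosh (Real.pi * τ) := by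
      have h2 := Real.cosh_two_mul (Real.pi * τ / 2)
      rw [mul_div_cancel₀ _ two_ne_zero] at h2
      nlinarith [sq_nonneg (Real.sinh (Real.pi * τ / 2))]
    have e2 := inv_norm_Gamma_sq_le τ
    refine (sq_le_sq₀ (by positivity) (by positivity)).1 ?_
    rw [div_pow, inv_pow (Real.cosh _), div_le_iff₀ (by positivity)]
    calc _ ≤ Real.cosh (Real.pi * τ) := e2
      _ ≤ (Real.cosh (Real.pi * τ / 2) ^ 2)⁻¹ * Real.cosh (Real.pi * τ) ^ 2 := by
        rw [inv_mul_eq_div, le_div_iff₀ (by positivity), sq (Real.cosh (Real.pi * τ))]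
        gcongr
  rw [lebedevSkalskayaKernel, norm_mul, Real.norm_eq_abs, Real.norm_eq_abs,
    abs_of_pos (by have := Real.pi_pos; positivity)]
  calc _ ≤ √Real.pi / Real.cosh (Real.pi * τ) * Real.exp (-x / 2) *
        (‖Complex.Gamma (1 + Complex.I * τ)‖⁻¹ * Real.cosh (x / 2)) := by gcongr
    _ = √Real.pi * Real.exp (-x / 2) * Real.cosh (x / 2) *
        (‖Complex.Gamma (1 + Complex.I * τ)‖⁻¹ / Real.cosh (Real.pi * τ)) := by ring
    _ ≤ _ := by
        have := Real.cosh_pos (x / 2)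
        gcongr

lemma integrable_cos_mul_lebedevSkalskayaKernel {x : ℝ} (hx : 0 < x) (y : ℝ) :
    Integrable fun τ => Real.cos (τ * y) * lebedevSkalskayaKernel τ x :=
  (integrable_lebedevSkalskayaKernel hx).bdd_mul (c := 1) (by fun_prop)
    (ae_of_all _ fun _ => Real.abs_cos_le_one _)

lemma exp_mul_I_add_exp_neg_mul_I (a : ℝ) (c : ℂ) :
    Complex.exp ((a : ℂ) * Complex.I) * c + Complex.exp (((-a : ℝ) : ℂ) * Complex.I) * c =
      2 * ((Real.cos a : ℝ) : ℂ) * c := by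
  rw [Complex.exp_mul_I, Complex.exp_mul_I]
  push_cast
  rw [Complex.cos_neg, Complex.sin_neg]
  ring

/-- The Fourier transform of an even real function is twice its cosine transform. -/
lemma integral_exp_mul_I_mul_of_even {f : ℝ → ℝ} (hf : Integrable f) (heven : ∀ y, f (-y) = f y)
    (a : ℝ) :
    ∫ y, Complex.exp (((a * y : ℝ) : ℂ) * Complex.I) * (f y : ℂ) =
      ((2 * ∫ y in Ioi (0 : ℝ), Real.cos (a * y) * f y : ℝ) : ℂ) := by
  have hint : Integrable fun y : ℝ => Complex.exp (((a * y : ℝ) : ℂ) * Complex.I) * (f y : ℂ) :=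
    hf.ofReal.bdd_mul (c := 1) (by fun_prop)
      (ae_of_all _ fun y => (Complex.norm_exp_ofReal_mul_I _).le)
  rw [integral_eq_integral_Ioi_add hint]
  simp_rw [heven, mul_neg, exp_mul_I_add_exp_neg_mul_I]
  rw [← integral_const_mul, ← integral_complex_ofReal]
  refine integral_congr_ae (ae_of_all _ fun y => ?_)
  push_cast
  ring

/-- Fourier inversion of `lebedevSkalskayaKernel_eq_integral`. Mathlib's transform has the phase
`-2πwy`, so that its value at `w` is the kernel at `τ = -2πw`. -/
lemma integral_cos_mul_lebedevSkalskayaKernel {x : ℝ} (hx : 0 < x) (y : ℝ) :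
    ∫ τ in Ioi (0 : ℝ), Real.cos (τ * y) * lebedevSkalskayaKernel τ x =
      √x * (Real.cosh (y / 2) * kummerF (1 : ℝ) (3 / 2) (-x * Real.cosh (y / 2) ^ 2)) := by
  set g : ℝ → ℝ := fun y =>
    Real.cosh (y / 2) * kummerF (1 : ℝ) (3 / 2) (-x * Real.cosh (y / 2) ^ 2) with hg
  have hsx : 0 < √x := Real.sqrt_pos.2 hx
  have hgint : Integrable g := by
    have h := integrable_cos_mul_cosh_mul_kummerF 0 hx
    simp only [zero_mul, Real.cos_zero, one_mul] at h
    exact h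
  have hgcont : Continuous g :=
    continuous_cosh_mul_kummerF.comp (f := fun y : ℝ => (x, y)) (by fun_prop)
  have hgeven : ∀ y, g (-y) = g y := fun y => by simp only [hg, neg_div, Real.cosh_neg]
  have hΨ : ∀ τ, 2 * ∫ y in Ioi (0 : ℝ), Real.cos (τ * y) * g y =
      Real.pi / √x * lebedevSkalskayaKernel τ x := by
    intro τ
    rw [lebedevSkalskayaKernel_eq_integral τ hx]
    simp only [hg, ← mul_assoc]
    set J := ∫ y in Ioi (0 : ℝ), Real.cos (τ * y) * Real.cosh (y / 2) *
      kummerF (1 : ℝ) (3 / 2) (-x * Real.cosh (y / 2) ^ 2)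
    have := Real.pi_ne_zero
    field_simp
  set gc : ℝ → ℂ := fun y => (g y : ℂ) with hgc
  have hF : 𝓕 gc = fun w =>
      ((Real.pi / √x * lebedevSkalskayaKernel (-(2 * Real.pi) * w) x : ℝ) : ℂ) := by
    ext w
    rw [Real.fourier_eq', ← hΨ, ← integral_exp_mul_I_mul_of_even hgint hgeven]
    refine integral_congr_ae (ae_of_all _ fun v => ?_)
    simp only [smul_eq_mul, hgc, RCLike.inner_apply, conj_trivial]
    ring_nf
  have h2pi : -(2 * Real.pi) ≠ 0 := by have := Real.pi_pos; linarith
  have hFint : Integrable (𝓕 gc) := by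
    rw [hF]
    exact (((integrable_lebedevSkalskayaKernel hx).comp_mul_left' h2pi).const_mul _).ofReal
  have hinv : 𝓕⁻ (𝓕 gc) y = gc y := congrFun (Continuous.fourierInv_fourier_eq
    (Complex.continuous_ofReal.comp hgcont) hgint.ofReal hFint) y
  rw [Real.fourierInv_eq', hF] at hinv
  have hsub : ∫ w : ℝ, Complex.exp (((2 * Real.pi * inner ℝ w y : ℝ) : ℂ) * Complex.I) •
      ((Real.pi / √x * lebedevSkalskayaKernel (-(2 * Real.pi) * w) x : ℝ) : ℂ) =
      ((1 / √x * ∫ τ in Ioi (0 : ℝ), Real.cos (τ * y) * lebedevSkalskayaKernel τ x : ℝ) : ℂ) := by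
    have h1 := integral_exp_mul_I_mul_of_even (integrable_lebedevSkalskayaKernel hx)
      (fun τ => lebedevSkalskayaKernel_neg τ hx) (-y)
    have h2 := Measure.integral_comp_mul_left (fun τ : ℝ =>
      Complex.exp (((-y * τ : ℝ) : ℂ) * Complex.I) * (lebedevSkalskayaKernel τ x : ℂ))
      (-(2 * Real.pi))
    rw [h1] at h2
    have h3 : ∀ w : ℝ, Complex.exp (((2 * Real.pi * inner ℝ w y : ℝ) : ℂ) * Complex.I) •
        ((Real.pi / √x * lebedevSkalskayaKernel (-(2 * Real.pi) * w) x : ℝ) : ℂ) =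
        ((Real.pi / √x : ℝ) : ℂ) *
        (Complex.exp (((-y * (-(2 * Real.pi) * w) : ℝ) : ℂ) * Complex.I) *
          (lebedevSkalskayaKernel (-(2 * Real.pi) * w) x : ℂ)) := by
      intro w
      simp only [smul_eq_mul, RCLike.inner_apply, conj_trivial]
      rw [show 2 * Real.pi * (y * w) = -y * (-(2 * Real.pi) * w) by ring]
      push_cast
      ring
    simp_rw [h3]
    rw [integral_const_mul, h2, Complex.real_smul, ← Complex.ofReal_mul, ← Complex.ofReal_mul]
    congr 1
    rw [abs_inv, abs_neg, abs_of_pos (by have := Real.pi_pos; positivity)]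
    have h4 : ∀ τ : ℝ, Real.cos (-y * τ) = Real.cos (τ * y) := fun τ => by
      rw [neg_mul, Real.cos_neg, mul_comm]
    simp_rw [h4]
    set J := ∫ τ in Ioi (0 : ℝ), Real.cos (τ * y) * lebedevSkalskayaKernel τ x
    have := Real.pi_ne_zero
    field_simp
  rw [hsub] at hinv
  have hreal : 1 / √x * ∫ τ in Ioi (0 : ℝ), Real.cos (τ * y) * lebedevSkalskayaKernel τ x = g y :=
    Complex.ofReal_injective hinv
  change _ = √x * g y
  rw [← hreal, ← mul_assoc, mul_one_div_cancel hsx.ne', one_mul]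

lemma cos_div_cosh_mul_besselI_re_eq (x y τ : ℝ) :
    Real.cos (τ * y) / Real.cosh (Real.pi * τ) *
      (besselI (Complex.I * (τ : ℂ)) ((x / 2 : ℝ) : ℂ)).re =
      Real.exp (x / 2) / √Real.pi * (Real.cos (τ * y) * lebedevSkalskayaKernel τ x) := by
  have h1 : 0 < √Real.pi := Real.sqrt_pos.2 Real.pi_pos
  have h2 : Real.exp (x / 2) * Real.exp (-x / 2) = 1 := by
    rw [← Real.exp_add]
    ring_nf
    exact Real.exp_zero
  have h3 := Real.cosh_pos (Real.pi * τ)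
  rw [neg_div] at h2
  rw [lebedevSkalskayaKernel, neg_div]
  field_simp
  linear_combination (-Real.cos (τ * y) * (besselI (Complex.I * (τ : ℂ)) ((x / 2 : ℝ) : ℂ)).re) * h2

end LebedevSkalskaya

open LebedevSkalskaya in
theorem lemma2 :
    (∀ x y : ℝ, 0 < x → 0 < y →
      MeasureTheory.IntegrableOn
        (fun τ : ℝ => Real.cos (τ * y) / Real.cosh (Real.pi * τ) *
          (besselI (Complex.I * (τ : ℂ)) ((x / 2 : ℝ) : ℂ)).re)
        (Set.Ioi 0) MeasureTheory.volume ∧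
      ∫ τ in Set.Ioi (0 : ℝ), Real.cos (τ * y) / Real.cosh (Real.pi * τ) *
          (besselI (Complex.I * (τ : ℂ)) ((x / 2 : ℝ) : ℂ)).re =
        √(x / Real.pi) * Real.exp (x / 2) * Real.cosh (y / 2) *
          kummerF (1 : ℝ) (3 / 2) (-x * Real.cosh (y / 2) ^ 2)) ∧
    (∀ x τ : ℝ, 0 < x →
      MeasureTheory.IntegrableOn
        (fun y : ℝ => Real.cos (τ * y) * Real.cosh (y / 2) *
          kummerF (1 : ℝ) (3 / 2) (-x * Real.cosh (y / 2) ^ 2))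
        (Set.Ioi 0) MeasureTheory.volume ∧
      lebedevSkalskayaKernel τ x =
        2 * √x / Real.pi * ∫ y in Set.Ioi (0 : ℝ), Real.cos (τ * y) * Real.cosh (y / 2) *
          kummerF (1 : ℝ) (3 / 2) (-x * Real.cosh (y / 2) ^ 2)) := by
  refine ⟨fun x y hx _ => ?_, fun x τ hx =>
    ⟨(integrable_cos_mul_cosh_mul_kummerF τ hx).integrableOn,
      lebedevSkalskayaKernel_eq_integral τ hx⟩⟩
  simp_rw [cos_div_cosh_mul_besselI_re_eq]
  refine ⟨((integrable_cos_mul_lebedevSkalskayaKernel hx y).const_mul _).integrableOn, ?_⟩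
  rw [MeasureTheory.integral_const_mul, integral_cos_mul_lebedevSkalskayaKernel hx,
    Real.sqrt_div hx.le]
  ring
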